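/- **Parameters.** Fix a base type $b\in\{\mathsf{bool},\mathsf{int}\}$ and, for each $k\ge 0$, a set of symbols $\mathsf{op}_k$, each denoting a function $[\![\mathsf{op}_k]\!]$ from $k$-tuples of constants of type $b$ to constants of type $b$. For $b=\mathsf{int}$, "true" means non-zero and "false" means $0$. **Source language $\mathrm{PCF}^{\mathrm{lin}}_{\mathrm{ref}}(b)$.** Types are $\rho::=b\mid \mathsf{ref}\,\rho$ (base and reference types), $\tau::=\mathsf{unit}\mid\rho\mid\tau_1\xrightarrow{n}\tau_2$ with $n\in\mathbb N$ (normal types), $\sigma::=\tau\mid\tau_1\xrightarrow{\Delta}\tau_2$ (full types), where $\Delta=x_1{:}\tau_1,\dots,x_k{:}\tau_k$ is a normal type environment; a (full) type environment is a sequence $\Gamma=x_1{:}\sigma_1,\dots,x_k{:}\sigma_k$. The variables in an environment are mutually different. Every variable is annotated with its type ($x^\sigma$). Terms are $$M::=\mathsf{FAIL}\mid ()\mid c\mid x\mid \mathsf{op}_k(x_1,\dots,x_k)\mid\, !x\mid\mathsf{mkref}\,x\mid y:=x\mid\mathsf{let}\,x=M_1\,\mathsf{in}\,M_2\mid\mathsf{if}\,x\,\mathsf{then}\,M_1\,\mathsf{else}\,M_2\mid\lambda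 x.M\mid\mathsf{fix}(f,x,M)\mid f\,x .$$ Base types are $\mathsf{unit}$ and $b$. The sharable types are $\mathsf{unit}$, $b$ and $\tau_1\xrightarrow{0}\tau_2$. $\Gamma\setminus x$ removes the binding of $x$; $\Gamma\ominus_\sigma x$ is $\Gamma$ if $\sigma$ is sharable and $\Gamma\setminus x$ otherwise; $\Gamma\ominus x=\Gamma\ominus_{\Gamma(x)}x$. $\mathrm{split}(\Gamma,S)=(\Gamma_1,\Gamma_2)$, where $\Gamma_1$ consists of the bindings of variables in $S$ and $\Gamma_2$ of the bindings of variables that are not in $S$ or have sharable type. Sizes: $|\mathsf{unit}|=|b|=0$, $|\mathsf{ref}\,\rho|=1$, $|\tau_1\xrightarrow{n}\tau_2|=n$, and $|\Delta|$ is the sum over its bindings. **Target language $\mathrm{PCF}(b)$** (pure, call-by-value, with tuples): $N::=\mathsf{FAIL}\mid()\mid c\mid x\mid\mathsf{op}_k(x_1,\dots,x_k)\mid(N_1,\dots,N_k)\mid N.j\mid\mathsf{let}\,x=N_1\,\mathsf{in}\,N_2\mid\mathsf{if}\,x\,\mathsf{then}\,N_1\,\mathsf{else}\,N_2\mid\lambda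 x.N\mid\mathsf{fix}(f,x,N)\mid f\,N$. Pattern bindings such as $\mathsf{let}\,(x,y)=N_1\,\mathsf{in}\,N_2$ and $\lambda(x,y).N$ abbreviate bindings of the projections. A closure is the pair $\langle N\rangle_{h}:=(h,N)$ of its local store and its code; for a variable $f$, $f.\mathsf{env}$ and $f.\mathsf{code}$ denote its first and second component. $\mathrm{pack}_\Gamma$ is the flat tuple that lists, in the order of $\Gamma$, $x$ for each $x{:}\mathsf{ref}\,\rho$ and the $n$ components of $f.\mathsf{env}$ for each $f{:}\tau_1\xrightarrow{n}\tau_2$ in $\Gamma$ (other bindings contribute nothing). $\mathrm{unpack}_\Gamma\,h\,\mathsf{in}\,N$ conversely rebinds, from the successive components of the tuple $h$, each such $x$, and each such $f$ with $n>0$ to $\langle f.\mathsf{code}\rangle_{u}$ where $u$ is the tuple of the corresponding $n$ components, and then continues with $N$. **Translation.** $\Gamma\vdash M:\tau\dashv\Gamma'\leadsto N$ is the least relation closed under the following rules ($h,h',r$ fresh; omitting "$\leadsto N$" gives the typing rules). In every judgment $\Delta$ is required to be a subsequence of $\Gamma$ whenever some $f:\tau_1\xrightarrow{\Delta}\tau_2$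 occurs in $\Gamma$. - $\Gamma\vdash\mathsf{FAIL}:\tau\dashv\Gamma\leadsto(\mathsf{FAIL},\mathrm{pack}_\Gamma)$ for $\tau$ a base type; $\Gamma\vdash():\mathsf{unit}\dashv\Gamma\leadsto((),\mathrm{pack}_\Gamma)$; $\Gamma\vdash c:b\dashv\Gamma\leadsto(c,\mathrm{pack}_\Gamma)$. - If $\Gamma(x)=\tau$: $\Gamma\vdash x:\tau\dashv\Gamma\ominus x\leadsto(x,\mathrm{pack}_{\Gamma\ominus x})$. - If $\Gamma(x_i)=b$ for all $i$: $\Gamma\vdash\mathsf{op}_k(\vec x):b\dashv\Gamma\leadsto(\mathsf{op}_k(\vec x),\mathrm{pack}_\Gamma)$. - If $\Gamma(x)=\mathsf{ref}\,\rho$: $\Gamma\vdash\,!x:\rho\dashv\Gamma'\leadsto(x,\mathrm{pack}_{\Gamma'})$ with $\Gamma'=\Gamma\ominus_\rho x$. - If $\Gamma(x)=\rho$: $\Gamma\vdash\mathsf{mkref}\,x:\mathsf{ref}\,\rho\dashv\Gamma\ominus x\leadsto(x,\mathrm{pack}_{\Gamma\ominus x})$. - If $\Gamma(y)=\mathsf{ref}\,\rho$,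 $\Gamma(x)=\rho$: $\Gamma\vdash y:=x:\mathsf{unit}\dashv\Gamma\ominus x\leadsto\mathsf{let}\,y=x\,\mathsf{in}\,((),\mathrm{pack}_{\Gamma\ominus x})$. - If $\Gamma\vdash M_1:\tau'\dashv\Gamma''\leadsto N_1$ and $\Gamma'',x{:}\tau'\vdash M_2:\tau\dashv\Gamma'\leadsto N_2$: $\Gamma\vdash\mathsf{let}\,x=M_1\,\mathsf{in}\,M_2:\tau\dashv\Gamma'\setminus x\leadsto\mathsf{let}\,(x,h)=N_1\,\mathsf{in}\,\mathrm{unpack}_{\Gamma''}\,h\,\mathsf{in}\,N_2$. - If $\Gamma(x)=b$ and $\Gamma\vdash M_i:\tau\dashv\Gamma'\leadsto N_i$ ($i=1,2$): $\Gamma\vdash\mathsf{if}\,x\,\mathsf{then}\,M_1\,\mathsf{else}\,M_2:\tau\dashv\Gamma'\leadsto\mathsf{if}\,x\,\mathsf{then}\,N_1\,\mathsf{else}\,N_2$. - If $(\Delta,\Gamma')=\mathrm{split}(\Gamma,\mathrm{FV}(\lambda x.M))$ and $\Delta,x{:}\tau_1\vdash M:\tau_2\dashv\Delta,x{:}\tau_1\leadsto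 N$: $\Gamma\vdash\lambda x.M:\tau_1\xrightarrow{|\Delta|}\tau_2\dashv\Gamma'\leadsto(\langle\lambda(x,h).\,\mathrm{unpack}_\Delta\,h\,\mathsf{in}\,\mathsf{let}\,(r,h')=N\,\mathsf{in}\,\mathrm{unpack}_{\Delta,x:\tau_1}\,h'\,\mathsf{in}\,(r,x,\mathrm{pack}_\Delta)\rangle_{\mathrm{pack}_\Delta},\mathrm{pack}_{\Gamma'})$. - If $(\Delta,\Gamma')=\mathrm{split}(\Gamma,\mathrm{FV}(\mathsf{fix}(f,x,M)))$ and $\Theta\vdash M:\tau_2\dashv\Theta\leadsto N$ for $\Theta=\Delta,f{:}\tau_1\xrightarrow{\Delta}\tau_2,x{:}\tau_1$: $\Gamma\vdash\mathsf{fix}(f,x,M):\tau_1\xrightarrow{|\Delta|}\tau_2\dashv\Gamma'\leadsto(\langle\mathsf{fix}(f,(x,h),\mathrm{unpack}_\Delta\,h\,\mathsf{in}\,\mathsf{let}\,(r,h')=N\,\mathsf{in}\,\mathrm{unpack}_{\Theta}\,h'\,\mathsf{in}\,(r,x,\mathrm{pack}_\Delta))\rangle_{\mathrm{pack}_\Delta},\mathrm{pack}_{\Gamma'})$.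 - If $\Gamma(f)=\tau_1\xrightarrow{m}\tau_2$, $\Gamma(x)=\tau_1$: $\Gamma\vdash f\,x:\tau_2\dashv\Gamma\leadsto\mathsf{let}\,(r,x,h)=f.\mathsf{code}\,(x,f.\mathsf{env})\,\mathsf{in}\,\mathsf{let}\,f=\langle f.\mathsf{code}\rangle_{h}\,\mathsf{in}\,(r,\mathrm{pack}_\Gamma)$. - If $\Gamma(f)=\tau_1\xrightarrow{\Delta}\tau_2$, $\Gamma(x)=\tau_1$ and $\Delta$ is a subsequence of $\Gamma\setminus\{f,x\}$: $\Gamma\vdash f\,x:\tau_2\dashv\Gamma\leadsto\mathsf{let}\,h=\mathrm{pack}_\Delta\,\mathsf{in}\,\mathsf{let}\,(r,x,h')=f(x,h)\,\mathsf{in}\,\mathrm{unpack}_\Delta\,h'\,\mathsf{in}\,(r,\mathrm{pack}_\Gamma)$. **Big-step semantics.** Source values are constants (including $()$), locations, and closures $\langle\lambda x.M\rangle_R$, $\langle\mathsf{fix}(f,x,M)\rangle_R$; an environment $R$ maps variables to values and a heap $H$ maps locations to constants and locations. $(M,R,H)\Downarrow(v,R',H')$ or $(M,R,H)\Downarrow\mathsf{FAIL}$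 is the standard call-by-value evaluation with lexical scoping, a fresh location for each $\mathsf{mkref}$, and left-to-right propagation of $\mathsf{FAIL}$, in which the environment is updated as the type environment is: $x$ and $\mathsf{mkref}\,x$ and $y:=x$ remove $x$ from $R$ unless its type is sharable; $!x$ with $x$ of type $\mathsf{ref}\,\rho$ removes $x$ unless $\rho$ is sharable; a function $F$ captures $R$ restricted to $\mathrm{FV}(F)$ and leaves the bindings of variables that are not in $\mathrm{FV}(F)$ or have sharable type; $\mathsf{let}\,x=M_1\,\mathsf{in}\,M_2$ removes $x$ at the end; $f\,x$ leaves $R$ unchanged. For the target, $(N,S)\Downarrow w$ or $(N,S)\Downarrow\mathsf{FAIL}$ is the standard call-by-value evaluation with environments $S$ and closures, without a heap. **Theorem.** Let $\tau$ be a base type, $M$ a (necessarily closed) source term and $N$ a target term with $\varepsilon\vdash M:\tau\dashv\varepsilon\leadsto N$, where $\varepsilon$ is the empty type environment. Then $$(M,\emptyset,\emptyset)\Downarrow\mathsf{FAIL}\quad\text{if and only if}\quad(N,\emptyset)\Downarrow\mathsf{FAIL}.$$ -/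

import Mathlib

namespace LinRef

/-! ### Parameters: the base type and its operations -/

/-- The base type `b`, either `bool` or `int`. -/
inductive BaseTy where
  | bool
  | int

/-- The constants of the base type. -/
def BaseTy.Carrier : BaseTy → Type
  | .bool => Bool
  | .int => ℤ

/-- Constants counting as `true` in conditionals; for integers, the non-zero ones. -/
def BaseTy.Truthy : (b : BaseTy) → b.Carrier → Prop
  | .bool, c => c = true
  | .int, c => c ≠ (0 : ℤ)

/-- The language parameters: the base type `b`, the symbols for `k`-ary operations on constants
of type `b`, and the mathematical function denoted by each symbol. -/
structure Lang where
  base : BaseTy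
  Op : ℕ → Type
  sem : {k : ℕ} → Op k → (Fin k → base.Carrier) → base.Carrier

/-! ### Types of the source language -/

/-- Base and reference types `ρ ::= b | ref ρ`. -/
inductive RTy where
  | base
  | ref (ρ : RTy)
  deriving DecidableEq

/-- Normal types `τ ::= unit | ρ | τ₁ →ⁿ τ₂`. -/
inductive NTy where
  | unit
  | r (ρ : RTy)
  | fn (τ₁ : NTy) (n : ℕ) (τ₂ : NTy)
  deriving DecidableEq

/-- Full types `σ ::= τ | τ₁ →^Δ τ₂`, with `Δ` a normal type environment, that is, a sequence of
bindings of names to normal types. -/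
inductive FTy where
  | n (τ : NTy)
  | rfun (τ₁ : NTy) (Δ : List (ℕ × NTy)) (τ₂ : NTy)
  deriving DecidableEq

/-- The type of a value of base type `b`, as a normal type. -/
abbrev NTy.b : NTy := .r .base

/-- Base types: `unit` and `b`. -/
def NTy.IsBase (τ : NTy) : Prop := τ = .unit ∨ τ = .b

/-- Types of sharable values: base types and `τ₁ →⁰ τ₂`. -/
def FTy.sharable : FTy → Bool
  | .n .unit => true
  | .n (.r .base) => true
  | .n (.fn _ 0 _) => true
  | _ => false

/-- Number of base values held in a cell with contents of type `ρ`. -/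
def RTy.cellSize : RTy → ℕ
  | .base => 1
  | .ref ρ => ρ.cellSize

/-- `|τ|`, the size of the store owned by a value of type `τ`. -/
def NTy.size : NTy → ℕ
  | .unit => 0
  | .r .base => 0
  | .r (.ref ρ) => ρ.cellSize
  | .fn _ n _ => n

/-! ### Variables and type environments -/

/-- A variable `x^σ`: every variable carries its type (Church style). -/
structure Var where
  name : ℕ
  ty : FTy
  deriving DecidableEq

/-- The variable `x^τ` given by a binding `x : τ` of a normal type environment. -/
def Var.ofBinding (p : ℕ × NTy) : Var := ⟨p.1, .n p.2⟩

/-- Normal type environments `Δ = x₁ : τ₁, …, x_k : τ_k`. -/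
abbrev NTEnv := List (ℕ × NTy)

/-- Full type environments `Γ = x₁ : σ₁, …, x_k : σ_k`. A binding `x : σ` is the annotated
variable `x^σ`, so that `Γ(x) = σ` reads `x ∈ Γ ∧ x.ty = σ`. -/
abbrev TEnv := List Var

/-- A normal type environment as a full one. -/
def NTEnv.toTEnv (Δ : NTEnv) : TEnv := Δ.map Var.ofBinding

/-- `|Δ|`, the sum of the sizes of the bindings. -/
def NTEnv.size (Δ : NTEnv) : ℕ := (Δ.map fun p => p.2.size).sum

namespace TEnv

/-- `Γ(x) = σ`. -/
def Has (Γ : TEnv) (x : Var) (σ : FTy) : Prop := x ∈ Γ ∧ x.ty = σ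

/-- `Γ ∖ x`. -/
def erase (Γ : TEnv) (x : Var) : TEnv := Γ.filter (· ≠ x)

/-- `Γ` with the binding of `x` removed unless `σ` is sharable. -/
def excTy (Γ : TEnv) (x : Var) (σ : FTy) : TEnv := if σ.sharable then Γ else Γ.erase x

/-- `Γ` with the binding of `x` removed unless the type of `x` is sharable. -/
def exc (Γ : TEnv) (x : Var) : TEnv := Γ.excTy x x.ty

/-- The two components of `splitTE(Γ, S)`: the bindings of variables in `S`, and those of
variables outside `S` or of sharable type. -/
def split (Γ : TEnv) (S : Finset Var) : TEnv × TEnv :=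
  (Γ.filter (· ∈ S), Γ.filter fun x => x ∉ S ∨ x.ty.sharable)

/-- Well-formedness of the pre-environment of a judgment: the variables are mutually different,
and `Δ` is a subsequence of `Γ` whenever `f : τ₁ →^Δ τ₂` occurs in `Γ`. -/
def WF (Γ : TEnv) : Prop :=
  Γ.Nodup ∧ ∀ f ∈ Γ, ∀ τ₁ Δ τ₂, f.ty = .rfun τ₁ Δ τ₂ → (NTEnv.toTEnv Δ).Sublist Γ

end TEnv

/-! ### Source terms -/

/-- Terms of the source language. -/
inductive Term (L : Lang) where
  | fail
  | unit
  | const (c : L.base.Carrier)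
  | var (x : Var)
  | op {k : ℕ} (o : L.Op k) (xs : Fin k → Var)
  | deref (x : Var)
  | mkref (x : Var)
  /-- `assign y x` is `y := x`. -/
  | assign (y x : Var)
  /-- `letE x M₁ M₂` is `let x = M₁ in M₂`. -/
  | letE (x : Var) (M₁ M₂ : Term L)
  | ite (x : Var) (M₁ M₂ : Term L)
  | lam (x : Var) (M : Term L)
  /-- `fix f x M` is the recursive function `f` with `f(x) = M`. -/
  | fix (f x : Var) (M : Term L)
  | app (f x : Var)

/-- Free variables. -/
def Term.FV {L : Lang} : Term L → Finset Var
  | .fail => ∅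
  | .unit => ∅
  | .const _ => ∅
  | .var x => {x}
  | .op _ xs => Finset.univ.image xs
  | .deref x => {x}
  | .mkref x => {x}
  | .assign y x => {y, x}
  | .letE x M₁ M₂ => M₁.FV ∪ (M₂.FV \ {x})
  | .ite x M₁ M₂ => {x} ∪ M₁.FV ∪ M₂.FV
  | .lam x M => M.FV \ {x}
  | .fix f x M => M.FV \ {f, x}
  | .app f x => {f, x}

/-! ### Big-step semantics of the source language -/

/-- Values that a memory cell can hold: constants and locations. -/
inductive Atom (L : Lang) where
  | unit
  | const (c : L.base.Carrier)
  | loc (ℓ : ℕ)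

/-- Source values; a closure holds its environment. -/
inductive Val (L : Lang) where
  | atom (a : Atom L)
  | clos (x : Var) (M : Term L) (R : Var → Option (Val L))
  | rclos (f x : Var) (M : Term L) (R : Var → Option (Val L))

/-- Environments: partial maps from variables to values. -/
abbrev Env (L : Lang) := Var → Option (Val L)

/-- Heaps: partial maps from locations to constants and locations. -/
abbrev Heap (L : Lang) := ℕ → Option (Atom L)

namespace Env
variable {L : Lang}

/-- The empty environment. -/
def empty : Env L := fun _ => none

/-- `R{x ↦ v}`. -/
def set (R : Env L) (x : Var) (v : Val L) : Env L := Function.update R x (some v)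

/-- `R ∖ x`. -/
def erase (R : Env L) (x : Var) : Env L := Function.update R x none

/-- `R` with the binding of `x` removed unless `σ` is sharable. -/
def excTy (R : Env L) (x : Var) (σ : FTy) : Env L := if σ.sharable then R else R.erase x

/-- `R` with the binding of `x` removed unless the type of `x` is sharable. -/
def exc (R : Env L) (x : Var) : Env L := R.excTy x x.ty

/-- The two components of `splitEnv(R, S)`. -/
def split (R : Env L) (S : Finset Var) : Env L × Env L :=
  (fun x => if x ∈ S then R x else none,
   fun x => if x ∉ S ∨ x.ty.sharable then R x else none)

end Env

/-- The empty heap. -/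
def Heap.empty {L : Lang} : Heap L := fun _ => none

/-- `H{ℓ ↦ a}`. -/
def Heap.set {L : Lang} (H : Heap L) (ℓ : ℕ) (a : Atom L) : Heap L :=
  Function.update H ℓ (some a)

/-- Answers of the source evaluation: `(v, R, H)` or `FAIL`. -/
inductive Ans (L : Lang) where
  | ok (v : Val L) (R : Env L) (H : Heap L)
  | fail

/-- The evaluation relation `(M, R, H) ⇓ ans` of the source language. -/
inductive Eval {L : Lang} : Term L → Env L → Heap L → Ans L → Prop
  | fail {R H} : Eval .fail R H .fail
  | unit {R H} : Eval .unit R H (.ok (.atom .unit) R H)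
  | const {c R H} : Eval (.const c) R H (.ok (.atom (.const c)) R H)
  | var {x R H v} (hx : R x = some v) : Eval (.var x) R H (.ok v (R.exc x) H)
  | op {k R H} {o : L.Op k} {xs : Fin k → Var} {cs : Fin k → L.base.Carrier}
      (hxs : ∀ i, R (xs i) = some (.atom (.const (cs i)))) :
      Eval (.op o xs) R H (.ok (.atom (.const (L.sem o cs))) R H)
  | deref {x R H ρ ℓ a} (hty : x.ty = .n (.r (.ref ρ))) (hx : R x = some (.atom (.loc ℓ)))
      (hℓ : H ℓ = some a) :
      Eval (.deref x) R H (.ok (.atom a) (R.excTy x (.n (.r ρ))) H)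
  | mkref {x R H ℓ a} (hx : R x = some (.atom a)) (fresh : H ℓ = none) :
      Eval (.mkref x) R H (.ok (.atom (.loc ℓ)) (R.exc x) (H.set ℓ a))
  | assign {y x R H ℓ a} (hy : R y = some (.atom (.loc ℓ))) (hx : R x = some (.atom a)) :
      Eval (.assign y x) R H (.ok (.atom .unit) (R.exc x) (H.set ℓ a))
  | letE {x M₁ M₂ R H v₁ R₁ H₁ v₂ R₂ H₂} (h₁ : Eval M₁ R H (.ok v₁ R₁ H₁))
      (h₂ : Eval M₂ (R₁.set x v₁) H₁ (.ok v₂ R₂ H₂)) :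
      Eval (.letE x M₁ M₂) R H (.ok v₂ (R₂.erase x) H₂)
  | letF₁ {x M₁ M₂ R H} (h₁ : Eval M₁ R H .fail) : Eval (.letE x M₁ M₂) R H .fail
  | letF₂ {x M₁ M₂ R H v₁ R₁ H₁} (h₁ : Eval M₁ R H (.ok v₁ R₁ H₁))
      (h₂ : Eval M₂ (R₁.set x v₁) H₁ .fail) : Eval (.letE x M₁ M₂) R H .fail
  | iteT {x M₁ M₂ R H c ans} (hx : R x = some (.atom (.const c))) (hc : L.base.Truthy c)
      (h : Eval M₁ R H ans) : Eval (.ite x M₁ M₂) R H ans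
  | iteF {x M₁ M₂ R H c ans} (hx : R x = some (.atom (.const c))) (hc : ¬ L.base.Truthy c)
      (h : Eval M₂ R H ans) : Eval (.ite x M₁ M₂) R H ans
  | lam {x M R H} :
      Eval (.lam x M) R H
        (.ok (.clos x M (R.split (Term.lam x M).FV).1) (R.split (Term.lam x M).FV).2 H)
  | fix {f x M R H} :
      Eval (.fix f x M) R H
        (.ok (.rclos f x M (R.split (Term.fix f x M).FV).1) (R.split (Term.fix f x M).FV).2 H)
  | app₁ {f x R H y M Rf vx v R' H'} (hf : R f = some (.clos y M Rf)) (hx : R x = some vx)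
      (h : Eval M (Env.set Rf y vx) H (.ok v R' H')) : Eval (.app f x) R H (.ok v R H')
  | app₁F {f x R H y M Rf vx} (hf : R f = some (.clos y M Rf)) (hx : R x = some vx)
      (h : Eval M (Env.set Rf y vx) H .fail) : Eval (.app f x) R H .fail
  | app₂ {f x R H g y M Rf vx v R' H'} (hf : R f = some (.rclos g y M Rf)) (hx : R x = some vx)
      (h : Eval M (Env.set (Env.set Rf g (.rclos g y M Rf)) y vx) H (.ok v R' H')) :
      Eval (.app f x) R H (.ok v R H')
  | app₂F {f x R H g y M Rf vx} (hf : R f = some (.rclos g y M Rf)) (hx : R x = some vx)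
      (h : Eval M (Env.set (Env.set Rf g (.rclos g y M Rf)) y vx) H .fail) :
      Eval (.app f x) R H .fail

/-! ### The target language: pure PCF with tuples -/

/-- Target variables: those of the source, and reserved names for the auxiliary variables
that the translation introduces (which are thereby fresh). -/
inductive PVar where
  | src (x : Var)
  /-- a tuple being taken apart -/
  | p
  /-- a store -/
  | h
  /-- a result -/
  | r
  /-- the code of a closure about to be called -/
  | code
  deriving DecidableEq

/-- Target terms. Components of tuples are numbered from `0`. -/
inductive PTerm (L : Lang) where
  | fail
  | unit
  | const (c : L.base.Carrier)
  | var (x : PVar)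
  | op {k : ℕ} (o : L.Op k) (xs : Fin k → PVar)
  | tuple {k : ℕ} (Ns : Fin k → PTerm L)
  | proj (N : PTerm L) (j : ℕ)
  | letE (x : PVar) (N₁ N₂ : PTerm L)
  | ite (x : PVar) (N₁ N₂ : PTerm L)
  | lam (x : PVar) (N : PTerm L)
  | fix (f x : PVar) (N : PTerm L)
  | app (f : PVar) (N : PTerm L)

/-- Target values. -/
inductive PVal (L : Lang) where
  | unit
  | const (c : L.base.Carrier)
  | clos (x : PVar) (N : PTerm L) (S : PVar → Option (PVal L))
  | rclos (f x : PVar) (N : PTerm L) (S : PVar → Option (PVal L))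
  | tuple {k : ℕ} (ws : Fin k → PVal L)

/-- Target environments. -/
abbrev PEnv (L : Lang) := PVar → Option (PVal L)

/-- The empty target environment. -/
def PEnv.empty {L : Lang} : PEnv L := fun _ => none

/-- `S{x ↦ w}`. -/
def PEnv.set {L : Lang} (S : PEnv L) (x : PVar) (w : PVal L) : PEnv L :=
  Function.update S x (some w)

/-- Answers of the target evaluation: a value or `FAIL`. -/
inductive PAns (L : Lang) where
  | ok (w : PVal L)
  | fail

/-- The evaluation relation `(N, S) ⇓ ans` of the target language. -/
inductive PEval {L : Lang} : PTerm L → PEnv L → PAns L → Prop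
  | fail {S} : PEval .fail S .fail
  | unit {S} : PEval .unit S (.ok .unit)
  | const {c S} : PEval (.const c) S (.ok (.const c))
  | var {x S w} (hx : S x = some w) : PEval (.var x) S (.ok w)
  | op {k S} {o : L.Op k} {xs : Fin k → PVar} {cs : Fin k → L.base.Carrier}
      (hxs : ∀ i, S (xs i) = some (.const (cs i))) :
      PEval (.op o xs) S (.ok (.const (L.sem o cs)))
  | tuple {k S} {Ns : Fin k → PTerm L} {ws : Fin k → PVal L}
      (h : ∀ i, PEval (Ns i) S (.ok (ws i))) : PEval (.tuple Ns) S (.ok (.tuple ws))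
  | tupleF {k S} {Ns : Fin k → PTerm L} {ws : Fin k → PVal L} (i : Fin k)
      (h : ∀ j, j < i → PEval (Ns j) S (.ok (ws j))) (hi : PEval (Ns i) S .fail) :
      PEval (.tuple Ns) S .fail
  | proj {N S k} {ws : Fin k → PVal L} (j : Fin k) (h : PEval N S (.ok (.tuple ws))) :
      PEval (.proj N j) S (.ok (ws j))
  | projF {N S j} (h : PEval N S .fail) : PEval (.proj N j) S .fail
  | letE {x N₁ N₂ S w₁ ans} (h₁ : PEval N₁ S (.ok w₁)) (h₂ : PEval N₂ (S.set x w₁) ans) :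
      PEval (.letE x N₁ N₂) S ans
  | letF {x N₁ N₂ S} (h₁ : PEval N₁ S .fail) : PEval (.letE x N₁ N₂) S .fail
  | iteT {x N₁ N₂ S c ans} (hx : S x = some (.const c)) (hc : L.base.Truthy c)
      (h : PEval N₁ S ans) : PEval (.ite x N₁ N₂) S ans
  | iteF {x N₁ N₂ S c ans} (hx : S x = some (.const c)) (hc : ¬ L.base.Truthy c)
      (h : PEval N₂ S ans) : PEval (.ite x N₁ N₂) S ans
  | lam {x N S} : PEval (.lam x N) S (.ok (.clos x N S))
  | fix {f x N S} : PEval (.fix f x N) S (.ok (.rclos f x N S))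
  | app₁ {f N S y N₁ Sf v ans} (hN : PEval N S (.ok v)) (hf : S f = some (.clos y N₁ Sf))
      (h : PEval N₁ (PEnv.set Sf y v) ans) : PEval (.app f N) S ans
  | app₂ {f N S g y N₁ Sf v ans} (hN : PEval N S (.ok v)) (hf : S f = some (.rclos g y N₁ Sf))
      (h : PEval N₁ (PEnv.set (PEnv.set Sf g (.rclos g y N₁ Sf)) y v) ans) :
      PEval (.app f N) S ans
  | appF {f N S} (hN : PEval N S .fail) : PEval (.app f N) S .fail

/-! ### Derived forms of the target language -/

namespace PTerm
variable {L : Lang}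

/-- A source variable as a target term. -/
def v (x : Var) : PTerm L := .var (.src x)

/-- `(N₁, N₂)`. -/
def pair (N₁ N₂ : PTerm L) : PTerm L := .tuple ![N₁, N₂]

/-- `(N₁, N₂, N₃)`. -/
def triple (N₁ N₂ N₃ : PTerm L) : PTerm L := .tuple ![N₁, N₂, N₃]

/-- The flat tuple of the terms in a list. -/
def tupleOf (Ns : List (PTerm L)) : PTerm L := .tuple fun i : Fin Ns.length => Ns.get i

/-- A closure: the pair of its local store and its code. -/
def closure (code env : PTerm L) : PTerm L := pair env code

/-- The local store of the closure `f`. -/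
def envOf (f : Var) : PTerm L := .proj (v f) 0

/-- The code of the closure `f`. -/
def codeOf (f : Var) : PTerm L := .proj (v f) 1

/-- `let (x, y) = p in N`. -/
def split₂ (x y : PVar) (N : PTerm L) : PTerm L :=
  .letE x (.proj (.var .p) 0) (.letE y (.proj (.var .p) 1) N)

/-- `let (x, y) = N₁ in N₂`. -/
def letPair (x y : PVar) (N₁ N₂ : PTerm L) : PTerm L := .letE .p N₁ (split₂ x y N₂)

/-- `let (x, y, z) = N₁ in N₂`. -/
def letTriple (x y z : PVar) (N₁ N₂ : PTerm L) : PTerm L :=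
  .letE .p N₁ (.letE x (.proj (.var .p) 0)
    (.letE y (.proj (.var .p) 1) (.letE z (.proj (.var .p) 2) N₂)))

/-- `λ(x, y). N`. -/
def lamPair (x y : PVar) (N : PTerm L) : PTerm L := .lam .p (split₂ x y N)

/-- `fix f (x, y). N`. -/
def fixPair (f x y : PVar) (N : PTerm L) : PTerm L := .fix f .p (split₂ x y N)

/-- The components contributed to a store by one binding. -/
def packVar (x : Var) : List (PTerm L) :=
  match x.ty with
  | .n (.r (.ref _)) => [v x]
  | .n (.fn _ n _) => List.ofFn fun j : Fin n => .proj (envOf x) j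
  | _ => []

/-- `pack_Γ`: the flat tuple of the current contents of the store described by `Γ`. -/
def pack (Γ : TEnv) : PTerm L := tupleOf (Γ.flatMap packVar)

/-- Rebinding of the variables of `Γ` from the components of the store `h`, starting with the
component `i`. -/
def unpackFrom (N : PTerm L) : ℕ → TEnv → PTerm L
  | _, [] => N
  | i, x :: Γ =>
    match x.ty with
    | .n (.r (.ref _)) => .letE (.src x) (.proj (.var .h) i) (unpackFrom N (i + 1) Γ)
    | .n (.fn _ n _) =>
      if n = 0 then unpackFrom N i Γ
      else .letE (.src x)
        (closure (codeOf x) (.tuple fun j : Fin n => .proj (.var .h) (i + j)))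
        (unpackFrom N (i + n) Γ)
    | _ => unpackFrom N i Γ

/-- `unpack_Γ h in N`. -/
def unpack (Γ : TEnv) (N : PTerm L) : PTerm L := unpackFrom N 0 Γ

end PTerm

/-! ### The type-directed translation -/

open PTerm in
/-- The judgment `Γ ⊢ M : τ ⊣ Γ' ⇝ N`. Without the last argument, the rules are the typing rules
of the source language. -/
inductive Tr {L : Lang} : TEnv → Term L → NTy → TEnv → PTerm L → Prop
  | fail {Γ τ} (wf : Γ.WF) (hτ : τ.IsBase) : Tr Γ .fail τ Γ (pair .fail (pack Γ))
  | unit {Γ} (wf : Γ.WF) : Tr Γ .unit .unit Γ (pair .unit (pack Γ))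
  | const {Γ c} (wf : Γ.WF) : Tr Γ (.const c) .b Γ (pair (.const c) (pack Γ))
  | var {Γ x τ} (wf : Γ.WF) (hx : Γ.Has x (.n τ)) :
      Tr Γ (.var x) τ (Γ.exc x) (pair (v x) (pack (Γ.exc x)))
  | op {Γ k} {o : L.Op k} {xs : Fin k → Var} (wf : Γ.WF) (hxs : ∀ i, Γ.Has (xs i) (.n .b)) :
      Tr Γ (.op o xs) .b Γ (pair (.op o fun i => .src (xs i)) (pack Γ))
  | deref {Γ x ρ} (wf : Γ.WF) (hx : Γ.Has x (.n (.r (.ref ρ)))) :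
      Tr Γ (.deref x) (.r ρ) (Γ.excTy x (.n (.r ρ)))
        (pair (v x) (pack (Γ.excTy x (.n (.r ρ)))))
  | mkref {Γ x ρ} (wf : Γ.WF) (hx : Γ.Has x (.n (.r ρ))) :
      Tr Γ (.mkref x) (.r (.ref ρ)) (Γ.exc x) (pair (v x) (pack (Γ.exc x)))
  | assign {Γ y x ρ} (wf : Γ.WF) (hy : Γ.Has y (.n (.r (.ref ρ)))) (hx : Γ.Has x (.n (.r ρ))) :
      Tr Γ (.assign y x) .unit (Γ.exc x)
        (.letE (.src y) (v x) (pair .unit (pack (Γ.exc x))))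
  | letE {Γ Γ' Γ'' x τ τ' M₁ M₂ N₁ N₂} (hx : x.ty = .n τ') (h₁ : Tr Γ M₁ τ' Γ'' N₁)
      (h₂ : Tr (Γ'' ++ [x]) M₂ τ Γ' N₂) :
      Tr Γ (.letE x M₁ M₂) τ (Γ'.erase x) (letPair (.src x) .h N₁ (unpack Γ'' N₂))
  | ite {Γ Γ' x τ M₁ M₂ N₁ N₂} (hx : Γ.Has x (.n .b)) (h₁ : Tr Γ M₁ τ Γ' N₁)
      (h₂ : Tr Γ M₂ τ Γ' N₂) : Tr Γ (.ite x M₁ M₂) τ Γ' (.ite (.src x) N₁ N₂)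
  | lam {Γ Γ' x τ₁ τ₂ M N} {Δ : NTEnv} (wf : Γ.WF) (hx : x.ty = .n τ₁)
      (h : Tr (Δ.toTEnv ++ [x]) M τ₂ (Δ.toTEnv ++ [x]) N)
      (hs : (Δ.toTEnv, Γ') = Γ.split (Term.lam x M).FV) :
      Tr Γ (.lam x M) (.fn τ₁ Δ.size τ₂) Γ'
        (pair
          (closure
            (lamPair (.src x) .h (unpack Δ.toTEnv (letPair .r .h N
              (unpack (Δ.toTEnv ++ [x]) (triple (.var .r) (v x) (pack Δ.toTEnv))))))
            (pack Δ.toTEnv))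
          (pack Γ'))
  | fix {Γ Γ' f x τ₁ τ₂ M N} {Δ : NTEnv} (wf : Γ.WF) (hf : f.ty = .rfun τ₁ Δ τ₂)
      (hx : x.ty = .n τ₁)
      (h : Tr (Δ.toTEnv ++ [f, x]) M τ₂ (Δ.toTEnv ++ [f, x]) N)
      (hs : (Δ.toTEnv, Γ') = Γ.split (Term.fix f x M).FV) :
      Tr Γ (.fix f x M) (.fn τ₁ Δ.size τ₂) Γ'
        (pair
          (closure
            (fixPair (.src f) (.src x) .h (unpack Δ.toTEnv (letPair .r .h N
              (unpack (Δ.toTEnv ++ [f, x]) (triple (.var .r) (v x) (pack Δ.toTEnv))))))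
            (pack Δ.toTEnv))
          (pack Γ'))
  | app {Γ f x τ₁ m τ₂} (wf : Γ.WF) (hf : Γ.Has f (.n (.fn τ₁ m τ₂))) (hx : Γ.Has x (.n τ₁)) :
      Tr Γ (.app f x) τ₂ Γ
        (letTriple .r (.src x) .h
          (.letE .code (codeOf f) (.app .code (pair (v x) (envOf f))))
          (.letE (.src f) (closure (codeOf f) (.var .h)) (pair (.var .r) (pack Γ))))
  | rapp {Γ f x τ₁ τ₂} {Δ : NTEnv} (wf : Γ.WF) (hf : Γ.Has f (.rfun τ₁ Δ τ₂))
      (hx : Γ.Has x (.n τ₁)) (hΔ : Δ.toTEnv.Sublist ((Γ.erase f).erase x)) :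
      Tr Γ (.app f x) τ₂ Γ
        (.letE .h (pack Δ.toTEnv)
          (letTriple .r (.src x) .h (.app (.src f) (pair (v x) (.var .h)))
            (unpack Δ.toTEnv (pair (.var .r) (pack Γ)))))

end LinRef

/-!
A source value is related to a target value together with the set of heap locations that the source
value owns, the contents of these locations being the store components of the target value. Linear
typing keeps the sets owned by different variables disjoint, and an evaluation changes only
locations owned by its own variables, so a frame rule carries all other values through it unchanged.

Both semantics are recast as recursion on terms relative to an interpretation of calls, and calls
are graded by their nesting depth. Induction on the depth, and for each depth on the translation
derivation, shows that source and target have related answers. Since `mkref` is nondeterministic,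
this means that each answer of either side is matched by one of the other; `FAIL` is related only to
itself.
-/

namespace LinRef

open PTerm

variable {L : Lang}

/-! ### Evaluation relative to a relation for calls -/

/-- The answers of evaluating in sequence a term with answers `E` and then a continuation `K`,
where `FAIL` is propagated. -/
def Ans.Bind (E : Ans L → Prop) (K : Val L → Env L → Heap L → Ans L → Prop) (a : Ans L) : Prop :=
  (E .fail ∧ a = .fail) ∨ ∃ v R H, E (.ok v R H) ∧ K v R H a

/-- The answers of evaluating in sequence a target term with answers `P` and then a continuation
`K`, where `FAIL` is propagated. -/
def PAns.Bind (P : PAns L → Prop) (K : PVal L → PAns L → Prop) (a : PAns L) : Prop :=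
  (P .fail ∧ a = .fail) ∨ ∃ w, P (.ok w) ∧ K w a

theorem Ans.Bind.mono {E E' : Ans L → Prop} {K K' : Val L → Env L → Heap L → Ans L → Prop}
    {a : Ans L} (h : Ans.Bind E K a) (hE : ∀ a, E a → E' a)
    (hK : ∀ v R H a, K v R H a → K' v R H a) : Ans.Bind E' K' a :=
  h.imp (fun h => ⟨hE _ h.1, h.2⟩) fun ⟨v, R, H, h₁, h₂⟩ => ⟨v, R, H, hE _ h₁, hK _ _ _ _ h₂⟩

theorem PAns.Bind.mono {P P' : PAns L → Prop} {K K' : PVal L → PAns L → Prop} {a : PAns L}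
    (h : PAns.Bind P K a) (hP : ∀ a, P a → P' a) (hK : ∀ w a, K w a → K' w a) :
    PAns.Bind P' K' a :=
  h.imp (fun h => ⟨hP _ h.1, h.2⟩) fun ⟨w, h₁, h₂⟩ => ⟨w, hP _ h₁, hK _ _ h₂⟩

theorem Ans.bind_ok {E : Ans L → Prop} {a : Ans L} :
    Ans.Bind E (fun v R H a => a = .ok v R H) a ↔ E a := by
  cases a <;> simp [Ans.Bind]

theorem PAns.bind_ok {P : PAns L → Prop} {a : PAns L} :
    PAns.Bind P (fun w a => a = .ok w) a ↔ P a := by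
  cases a <;> simp [PAns.Bind]

/-- Source evaluation by recursion on the term, with the outcomes of calls given by `call`. -/
def Term.ev (call : Val L → Val L → Heap L → Ans L → Prop) :
    Term L → Env L → Heap L → Ans L → Prop
  | .fail, _, _, a => a = .fail
  | .unit, R, H, a => a = .ok (.atom .unit) R H
  | .const c, R, H, a => a = .ok (.atom (.const c)) R H
  | .var x, R, H, a => ∃ v, R x = some v ∧ a = .ok v (R.exc x) H
  | .op (k := k) o xs, R, H, a =>
    ∃ cs : Fin k → L.base.Carrier, (∀ i, R (xs i) = some (.atom (.const (cs i)))) ∧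
      a = .ok (.atom (.const (L.sem o cs))) R H
  | .deref x, R, H, a =>
    ∃ ρ ℓ b, x.ty = .n (.r (.ref ρ)) ∧ R x = some (.atom (.loc ℓ)) ∧ H ℓ = some b ∧
      a = .ok (.atom b) (R.excTy x (.n (.r ρ))) H
  | .mkref x, R, H, a =>
    ∃ ℓ b, R x = some (.atom b) ∧ H ℓ = none ∧ a = .ok (.atom (.loc ℓ)) (R.exc x) (H.set ℓ b)
  | .assign y x, R, H, a =>
    ∃ ℓ b, R y = some (.atom (.loc ℓ)) ∧ R x = some (.atom b) ∧
      a = .ok (.atom .unit) (R.exc x) (H.set ℓ b)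
  | .letE x M₁ M₂, R, H, a =>
    Ans.Bind (M₁.ev call R H) (fun v₁ R₁ H₁ =>
      Ans.Bind (M₂.ev call (R₁.set x v₁) H₁) fun v R₂ H₂ a => a = .ok v (R₂.erase x) H₂) a
  | .ite x M₁ M₂, R, H, a =>
    ∃ c, R x = some (.atom (.const c)) ∧
      ((L.base.Truthy c ∧ M₁.ev call R H a) ∨ (¬ L.base.Truthy c ∧ M₂.ev call R H a))
  | .lam x M, R, H, a =>
    a = .ok (.clos x M (R.split (Term.lam x M).FV).1) (R.split (Term.lam x M).FV).2 H
  | .fix f x M, R, H, a =>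
    a = .ok (.rclos f x M (R.split (Term.fix f x M).FV).1) (R.split (Term.fix f x M).FV).2 H
  | .app f x, R, H, a =>
    ∃ u v, R f = some u ∧ R x = some v ∧
      Ans.Bind (call u v H) (fun w _ H' a => a = .ok w R H') a

/-- Source calls of nesting depth at most `k`. -/
def Val.call : ℕ → Val L → Val L → Heap L → Ans L → Prop
  | k + 1, .clos y M R, v, H, a => M.ev (Val.call k) (Env.set R y v) H a
  | k + 1, .rclos g y M R, v, H, a =>
    M.ev (Val.call k) (Env.set (Env.set R g (.rclos g y M R)) y v) H a
  | _, _, _, _, _ => False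

/-- Target evaluation by recursion on the term, with the outcomes of calls given by `call`. -/
def PTerm.ev (call : PVal L → PVal L → PAns L → Prop) : PTerm L → PEnv L → PAns L → Prop
  | .fail, _, a => a = .fail
  | .unit, _, a => a = .ok .unit
  | .const c, _, a => a = .ok (.const c)
  | .var x, S, a => ∃ w, S x = some w ∧ a = .ok w
  | .op (k := k) o xs, S, a =>
    ∃ cs : Fin k → L.base.Carrier, (∀ i, S (xs i) = some (.const (cs i))) ∧
      a = .ok (.const (L.sem o cs))
  | .tuple Ns, S, a =>
    (∃ ws, (∀ i, (Ns i).ev call S (.ok (ws i))) ∧ a = .ok (.tuple ws)) ∨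
      ∃ i, ∃ ws : _ → PVal L, (∀ j, j < i → (Ns j).ev call S (.ok (ws j))) ∧
        (Ns i).ev call S .fail ∧ a = .fail
  | .proj N j, S, a =>
    PAns.Bind (N.ev call S)
      (fun w a => ∃ (k : ℕ) (ws : Fin k → PVal L) (hj : j < k),
        w = .tuple ws ∧ a = .ok (ws ⟨j, hj⟩)) a
  | .letE x N₁ N₂, S, a => PAns.Bind (N₁.ev call S) (fun w => N₂.ev call (S.set x w)) a
  | .ite x N₁ N₂, S, a =>
    ∃ c, S x = some (.const c) ∧
      ((L.base.Truthy c ∧ N₁.ev call S a) ∨ (¬ L.base.Truthy c ∧ N₂.ev call S a))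
  | .lam x N, S, a => a = .ok (.clos x N S)
  | .fix f x N, S, a => a = .ok (.rclos f x N S)
  | .app f N, S, a => PAns.Bind (N.ev call S) (fun w a => ∃ c, S f = some c ∧ call c w a) a

/-- Target calls of nesting depth at most `k`. -/
def PVal.call : ℕ → PVal L → PVal L → PAns L → Prop
  | k + 1, .clos y N S, w, a => N.ev (PVal.call k) (PEnv.set S y w) a
  | k + 1, .rclos g y N S, w, a =>
    N.ev (PVal.call k) (PEnv.set (PEnv.set S g (.rclos g y N S)) y w) a
  | _, _, _, _ => False

theorem Term.ev_mono {call call' : Val L → Val L → Heap L → Ans L → Prop} (hc : call ≤ call')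
    (M : Term L) {R : Env L} {H : Heap L} {a : Ans L} (h : M.ev call R H a) :
    M.ev call' R H a := by
  induction M generalizing R H a with
  | letE x M₁ M₂ ih₁ ih₂ =>
    exact Ans.Bind.mono h (fun _ => ih₁) fun _ _ _ _ h₂ => h₂.mono (fun _ => ih₂) fun _ _ _ _ => id
  | ite x M₁ M₂ ih₁ ih₂ =>
    obtain ⟨c, hx, h⟩ := h
    exact ⟨c, hx, h.imp (And.imp_right ih₁) (And.imp_right ih₂)⟩
  | app f x =>
    obtain ⟨u, v, hu, hv, h⟩ := h
    exact ⟨u, v, hu, hv, h.mono (hc u v H) fun _ _ _ _ => id⟩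
  | _ => exact h

theorem PTerm.ev_mono {call call' : PVal L → PVal L → PAns L → Prop} (hc : call ≤ call')
    (N : PTerm L) {S : PEnv L} {a : PAns L} (h : N.ev call S a) : N.ev call' S a := by
  induction N generalizing S a with
  | tuple Ns ih =>
    obtain ⟨ws, h, e⟩ | ⟨i, ws, h, hi, e⟩ := h
    · exact .inl ⟨ws, fun i => ih i (h i), e⟩
    · exact .inr ⟨i, ws, fun j hj => ih j (h j hj), ih i hi, e⟩
  | proj N j ih => exact PAns.Bind.mono h (fun _ => ih) fun _ _ => id
  | letE x N₁ N₂ ih₁ ih₂ => exact PAns.Bind.mono h (fun _ => ih₁) fun _ _ => ih₂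
  | ite x N₁ N₂ ih₁ ih₂ =>
    obtain ⟨c, hx, h⟩ := h
    exact ⟨c, hx, h.imp (And.imp_right ih₁) (And.imp_right ih₂)⟩
  | app f N ih =>
    exact PAns.Bind.mono h (fun _ => ih) fun w a ⟨c, hf, h⟩ => ⟨c, hf, hc c w a h⟩
  | _ => exact h

theorem Val.call_mono : Monotone (Val.call (L := L)) := by
  refine monotone_nat_of_le_succ fun k => ?_
  induction k with
  | zero => intro u v H a h; cases u <;> exact h.elim
  | succ k ih =>
    intro u v H a h
    cases u with
    | atom => exact h
    | clos y M R | rclos g y M R => exact M.ev_mono ih h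

theorem PVal.call_mono : Monotone (PVal.call (L := L)) := by
  refine monotone_nat_of_le_succ fun k => ?_
  induction k with
  | zero => intro c w a h; cases c <;> exact h.elim
  | succ k ih =>
    intro c w a h
    cases c with
    | clos y N S | rclos g y N S => exact N.ev_mono ih h
    | _ => exact h

theorem Eval.exists_ev {M : Term L} {R : Env L} {H : Heap L} {a : Ans L} (h : Eval M R H a) :
    ∃ k, M.ev (Val.call k) R H a := by
  induction h with
  | fail | unit | const | lam | fix => exact ⟨0, rfl⟩
  | var hx => exact ⟨0, _, hx, rfl⟩
  | op hxs => exact ⟨0, _, hxs, rfl⟩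
  | deref hty hx hℓ => exact ⟨0, _, _, _, hty, hx, hℓ, rfl⟩
  | mkref hx fresh => exact ⟨0, _, _, hx, fresh, rfl⟩
  | assign hy hx => exact ⟨0, _, _, hy, hx, rfl⟩
  | @letE x M₁ M₂ _ _ _ _ _ _ _ _ _ _ ih₁ ih₂ =>
    obtain ⟨k₁, h₁⟩ := ih₁
    obtain ⟨k₂, h₂⟩ := ih₂
    exact ⟨max k₁ k₂, .inr ⟨_, _, _, M₁.ev_mono (Val.call_mono (le_max_left _ _)) h₁,
      .inr ⟨_, _, _, M₂.ev_mono (Val.call_mono (le_max_right _ _)) h₂, rfl⟩⟩⟩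
  | letF₁ _ ih₁ => exact ih₁.imp fun k h => .inl ⟨h, rfl⟩
  | @letF₂ x M₁ M₂ _ _ _ _ _ _ _ ih₁ ih₂ =>
    obtain ⟨k₁, h₁⟩ := ih₁
    obtain ⟨k₂, h₂⟩ := ih₂
    exact ⟨max k₁ k₂, .inr ⟨_, _, _, M₁.ev_mono (Val.call_mono (le_max_left _ _)) h₁,
      .inl ⟨M₂.ev_mono (Val.call_mono (le_max_right _ _)) h₂, rfl⟩⟩⟩
  | iteT hx hc _ ih => exact ih.imp fun k h => ⟨_, hx, .inl ⟨hc, h⟩⟩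
  | iteF hx hc _ ih => exact ih.imp fun k h => ⟨_, hx, .inr ⟨hc, h⟩⟩
  | app₁ hf hx _ ih | app₂ hf hx _ ih =>
    obtain ⟨k, h⟩ := ih
    exact ⟨k + 1, _, _, hf, hx, .inr ⟨_, _, _, h, rfl⟩⟩
  | app₁F hf hx _ ih | app₂F hf hx _ ih =>
    obtain ⟨k, h⟩ := ih
    exact ⟨k + 1, _, _, hf, hx, .inl ⟨h, rfl⟩⟩

theorem Eval.of_ev {call : Val L → Val L → Heap L → Ans L → Prop}
    (hc : ∀ {f x} {R : Env L} {u v H a}, R f = some u → R x = some v →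
      Ans.Bind (call u v H) (fun w _ H' a => a = .ok w R H') a → Eval (.app f x) R H a)
    (M : Term L) {R : Env L} {H : Heap L} {a : Ans L} (h : M.ev call R H a) : Eval M R H a := by
  induction M generalizing R H a with
  | fail => obtain rfl := h; exact .fail
  | unit => obtain rfl := h; exact .unit
  | const c => obtain rfl := h; exact .const
  | var x => obtain ⟨v, hx, rfl⟩ := h; exact .var hx
  | op o xs => obtain ⟨cs, hxs, rfl⟩ := h; exact .op hxs
  | deref x => obtain ⟨ρ, ℓ, b, hty, hx, hℓ, rfl⟩ := h; exact .deref hty hx hℓ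
  | mkref x => obtain ⟨ℓ, b, hx, hℓ, rfl⟩ := h; exact .mkref hx hℓ
  | assign y x => obtain ⟨ℓ, b, hy, hx, rfl⟩ := h; exact .assign hy hx
  | letE x M₁ M₂ ih₁ ih₂ =>
    obtain ⟨h₁, rfl⟩ | ⟨v₁, R₁, H₁, h₁, ⟨h₂, rfl⟩ | ⟨v, R₂, H₂, h₂, rfl⟩⟩ := h
    · exact .letF₁ (ih₁ h₁)
    · exact .letF₂ (ih₁ h₁) (ih₂ h₂)
    · exact .letE (ih₁ h₁) (ih₂ h₂)
  | ite x M₁ M₂ ih₁ ih₂ =>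
    obtain ⟨c, hx, ⟨hc, h⟩ | ⟨hc, h⟩⟩ := h
    · exact .iteT hx hc (ih₁ h)
    · exact .iteF hx hc (ih₂ h)
  | lam x M => obtain rfl := h; exact .lam
  | fix f x M => obtain rfl := h; exact .fix
  | app f x => obtain ⟨u, v, hu, hv, h⟩ := h; exact hc hu hv h

theorem Eval.of_call (k : ℕ) {f x : Var} {R : Env L} {u v : Val L} {H : Heap L} {a : Ans L}
    (hu : R f = some u) (hv : R x = some v)
    (h : Ans.Bind (u.call k v H) (fun w _ H' a => a = .ok w R H') a) : Eval (.app f x) R H a := by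
  induction k generalizing f x R u v H a with
  | zero =>
    obtain ⟨h, -⟩ | ⟨w, R', H', h, -⟩ := h <;> cases u <;> exact h.elim
  | succ k ih =>
    obtain ⟨h, rfl⟩ | ⟨w, R', H', h, rfl⟩ := h
    · cases u with
      | atom => exact h.elim
      | clos y M Rf => exact .app₁F hu hv (Eval.of_ev ih M h)
      | rclos g y M Rf => exact .app₂F hu hv (Eval.of_ev ih M h)
    · cases u with
      | atom => exact h.elim
      | clos y M Rf => exact .app₁ hu hv (Eval.of_ev ih M h)
      | rclos g y M Rf => exact .app₂ hu hv (Eval.of_ev ih M h)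

theorem eval_iff_exists_ev {M : Term L} {R : Env L} {H : Heap L} {a : Ans L} :
    Eval M R H a ↔ ∃ k, M.ev (Val.call k) R H a :=
  ⟨Eval.exists_ev, fun ⟨k, h⟩ => Eval.of_ev (Eval.of_call k) M h⟩

theorem PTerm.exists_forall_ev_call {ι : Type*} [Finite ι] {S : PEnv L} {Ns : ι → PTerm L}
    {ws : ι → PVal L} {p : ι → Prop}
    (h : ∀ i, p i → ∃ j, (Ns i).ev (PVal.call j) S (.ok (ws i))) :
    ∃ j, ∀ i, p i → (Ns i).ev (PVal.call j) S (.ok (ws i)) := by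
  cases nonempty_fintype ι
  choose! js hjs using h
  exact ⟨Finset.univ.sup js, fun i hi => (Ns i).ev_mono
    (PVal.call_mono (Finset.le_sup (Finset.mem_univ i))) (hjs i hi)⟩

theorem PEval.exists_ev {N : PTerm L} {S : PEnv L} {a : PAns L} (h : PEval N S a) :
    ∃ k, N.ev (PVal.call k) S a := by
  induction h with
  | fail | unit | const | lam | fix => exact ⟨0, rfl⟩
  | var hx => exact ⟨0, _, hx, rfl⟩
  | op hxs => exact ⟨0, _, hxs, rfl⟩
  | @tuple k S Ns ws _ ih =>
    obtain ⟨k, h⟩ := PTerm.exists_forall_ev_call (p := fun _ => True) fun i _ => ih i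
    exact ⟨k, .inl ⟨ws, fun i => h i trivial, rfl⟩⟩
  | @tupleF k S Ns ws i _ _ ih ihi =>
    obtain ⟨k₁, h₁⟩ := PTerm.exists_forall_ev_call ih
    obtain ⟨k₂, h₂⟩ := ihi
    exact ⟨max k₁ k₂, .inr ⟨i, ws,
      fun j hj => (Ns j).ev_mono (PVal.call_mono (le_max_left _ _)) (h₁ j hj),
      (Ns i).ev_mono (PVal.call_mono (le_max_right _ _)) h₂, rfl⟩⟩
  | proj j _ ih => exact ih.imp fun k h => .inr ⟨_, h, _, _, j.2, rfl, rfl⟩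
  | projF _ ih | letF _ ih | appF _ ih => exact ih.imp fun k h => .inl ⟨h, rfl⟩
  | @letE x N₁ N₂ _ _ _ _ _ ih₁ ih₂ =>
    obtain ⟨k₁, h₁⟩ := ih₁
    obtain ⟨k₂, h₂⟩ := ih₂
    exact ⟨max k₁ k₂, .inr ⟨_, N₁.ev_mono (PVal.call_mono (le_max_left _ _)) h₁,
      N₂.ev_mono (PVal.call_mono (le_max_right _ _)) h₂⟩⟩
  | iteT hx hc _ ih => exact ih.imp fun k h => ⟨_, hx, .inl ⟨hc, h⟩⟩
  | iteF hx hc _ ih => exact ih.imp fun k h => ⟨_, hx, .inr ⟨hc, h⟩⟩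
  | @app₁ f N _ _ N₁ _ _ _ _ hf _ ih₁ ih₂ | @app₂ f N _ _ _ N₁ _ _ _ _ hf _ ih₁ ih₂ =>
    obtain ⟨k₁, h₁⟩ := ih₁
    obtain ⟨k₂, h₂⟩ := ih₂
    exact ⟨max k₁ k₂ + 1, .inr ⟨_, N.ev_mono (PVal.call_mono (by omega)) h₁, _, hf,
      N₁.ev_mono (PVal.call_mono (le_max_right _ _)) h₂⟩⟩

theorem PEval.of_ev {call : PVal L → PVal L → PAns L → Prop}
    (hc : ∀ {f N} {S : PEnv L} {c w a}, PEval N S (.ok w) → S f = some c → call c w a →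
      PEval (.app f N) S a)
    (N : PTerm L) {S : PEnv L} {a : PAns L} (h : N.ev call S a) : PEval N S a := by
  induction N generalizing S a with
  | fail => obtain rfl := h; exact .fail
  | unit => obtain rfl := h; exact .unit
  | const c => obtain rfl := h; exact .const
  | var x => obtain ⟨v, hx, rfl⟩ := h; exact .var hx
  | op o xs => obtain ⟨cs, hxs, rfl⟩ := h; exact .op hxs
  | tuple Ns ih =>
    obtain ⟨ws, h, rfl⟩ | ⟨i, ws, h, hi, rfl⟩ := h
    · exact .tuple fun i => ih i (h i)
    · exact .tupleF i (fun j hj => ih j (h j hj)) (ih i hi)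
  | proj N j ih =>
    obtain ⟨h, rfl⟩ | ⟨w, h, k, ws, hj, rfl, rfl⟩ := h
    · exact .projF (ih h)
    · exact .proj ⟨j, hj⟩ (ih h)
  | letE x N₁ N₂ ih₁ ih₂ =>
    obtain ⟨h, rfl⟩ | ⟨w, h₁, h₂⟩ := h
    · exact .letF (ih₁ h)
    · exact .letE (ih₁ h₁) (ih₂ h₂)
  | ite x N₁ N₂ ih₁ ih₂ =>
    obtain ⟨c, hx, ⟨hc, h⟩ | ⟨hc, h⟩⟩ := h
    · exact .iteT hx hc (ih₁ h)
    · exact .iteF hx hc (ih₂ h)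
  | lam x N => obtain rfl := h; exact .lam
  | fix f x N => obtain rfl := h; exact .fix
  | app f N ih =>
    obtain ⟨h, rfl⟩ | ⟨w, h₁, c, hf, h₂⟩ := h
    · exact .appF (ih h)
    · exact hc (ih h₁) hf h₂

theorem PEval.of_call (k : ℕ) {f : PVar} {N : PTerm L} {S : PEnv L} {c w : PVal L} {a : PAns L}
    (hN : PEval N S (.ok w)) (hf : S f = some c) (h : c.call k w a) :
    PEval (.app f N) S a := by
  induction k generalizing f N S c w a with
  | zero => cases c <;> exact h.elim
  | succ k ih =>
    cases c with
    | clos y N₁ Sf => exact .app₁ hN hf (PEval.of_ev ih N₁ h)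
    | rclos g y N₁ Sf => exact .app₂ hN hf (PEval.of_ev ih N₁ h)
    | _ => exact h.elim

theorem pEval_iff_exists_ev {N : PTerm L} {S : PEnv L} {a : PAns L} :
    PEval N S a ↔ ∃ k, N.ev (PVal.call k) S a :=
  ⟨PEval.exists_ev, fun ⟨k, h⟩ => PEval.of_ev (PEval.of_call k) N h⟩

/-! ### Tuples, closures and stores -/

/-- The tuple of a list of values. -/
def PVal.tup (us : List (PVal L)) : PVal L := .tuple us.get

/-- The target closure with local store `us` and code `c`. -/
def PVal.closure (us : List (PVal L)) (c : PVal L) : PVal L := .tuple ![.tup us, c]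

/-- The components of a tuple; there are none if the value is not a tuple. -/
def PVal.elems : PVal L → List (PVal L)
  | .tuple ws => List.ofFn ws
  | _ => []

/-- The components of the local store of a closure. -/
def PVal.store (w : PVal L) : List (PVal L) := (w.elems.headD .unit).elems

@[simp]
theorem PVal.store_closure (us : List (PVal L)) (c : PVal L) : (PVal.closure us c).store = us := by
  simp [PVal.store, PVal.closure, PVal.elems, PVal.tup]

theorem PVal.closure_inj {us us' : List (PVal L)} {c c' : PVal L} :
    PVal.closure us c = PVal.closure us' c' ↔ us = us' ∧ c = c' := by
  refine ⟨fun h => ?_, fun ⟨h₁, h₂⟩ => h₁ ▸ h₂ ▸ rfl⟩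
  have helems := congrArg PVal.elems h
  simp only [PVal.closure, PVal.elems, List.ofFn_inj] at helems
  exact ⟨by simpa using congrArg PVal.store h, by simpa using congrFun helems 1⟩

/-- The components contributed to a store by a value of type `σ`. -/
def FTy.comps : FTy → PVal L → List (PVal L)
  | .n (.r (.ref _)), w => [w]
  | .n (.fn _ _ _), w => w.store
  | _, _ => []

/-- The contents of the store described by `Γ`, when the variables have the values `w`. -/
def TEnv.comps (Γ : TEnv) (w : Var → PVal L) : List (PVal L) := Γ.flatMap fun x => x.ty.comps (w x)

/-- The two values of type `σ` agree but for their store components, and these are as many as `σ`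
requires. This is what `unpack` needs to know about the old value of a variable that it rebinds. -/
def FTy.SameCode : FTy → PVal L → PVal L → Prop
  | .n (.r (.ref _)), _, _ => True
  | .n (.fn _ m _), w, w' =>
    ∃ us us' c, w = PVal.closure us c ∧ w' = PVal.closure us' c ∧ us.length = m ∧ us'.length = m
  | _, w, w' => w = w'

theorem FTy.SameCode.trans {σ : FTy} {w₁ w₂ w₃ : PVal L} (h : σ.SameCode w₁ w₂)
    (h' : σ.SameCode w₂ w₃) : σ.SameCode w₁ w₃ := by
  rcases σ with (_ | (_ | _) | _) | _
  case n.fn =>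
    obtain ⟨us, us₀, c, rfl, rfl, hn, -⟩ := h
    obtain ⟨us', us₀', c', e, rfl, -, hn'⟩ := h'
    obtain ⟨rfl, rfl⟩ := PVal.closure_inj.1 e
    exact ⟨us, us₀', c, rfl, rfl, hn, hn'⟩
  case n.r.ref => trivial
  all_goals exact Eq.trans h h'

/-! ### Terms with a single outcome -/

theorem PAns.bind_iff_of_forall {P : PAns L → Prop} {K : PVal L → PAns L → Prop} {w : PVal L}
    (h : ∀ a, P a ↔ a = .ok w) (a : PAns L) : PAns.Bind P K a ↔ K w a := by
  simp [PAns.Bind, h]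

/-- The only outcome of `N` in `S` is the value `w`. -/
def PTerm.Returns (call : PVal L → PVal L → PAns L → Prop) (N : PTerm L) (S : PEnv L)
    (w : PVal L) : Prop :=
  ∀ a, N.ev call S a ↔ a = .ok w

@[simp]
theorem PEnv.set_self (S : PEnv L) (x : PVar) (w : PVal L) : S.set x w x = some w := by
  simp [PEnv.set]

@[simp]
theorem PEnv.set_of_ne (S : PEnv L) {x y : PVar} (h : y ≠ x) (w : PVal L) : S.set x w y = S y := by
  simp [PEnv.set, h]

theorem PEnv.set_eq_self {S : PEnv L} {x : PVar} {w : PVal L} (h : S x = some w) :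
    S.set x w = S := by
  rw [PEnv.set, ← h, Function.update_eq_self]

namespace PTerm

variable {call : PVal L → PVal L → PAns L → Prop} {S : PEnv L}

theorem returns_var {x : PVar} {w : PVal L} (h : S x = some w) :
    (PTerm.var x).Returns call S w := fun a => by
  simp [PTerm.ev, h]

theorem returns_tuple {k : ℕ} {Ns : Fin k → PTerm L} {ws : Fin k → PVal L}
    (h : ∀ i, (Ns i).Returns call S (ws i)) : (PTerm.tuple Ns).Returns call S (.tuple ws) := by
  intro a
  constructor
  · rintro (⟨ws', h', rfl⟩ | ⟨i, ws', -, hi, rfl⟩)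
    · have : ws' = ws := funext fun i => by simpa using (h i _).1 (h' i)
      rw [this]
    · simpa using (h i _).1 hi
  · rintro rfl
    exact .inl ⟨ws, fun i => (h i _).2 rfl, rfl⟩

theorem returns_tuple_tup {k : ℕ} {Ns : Fin k → PTerm L} {us : List (PVal L)} (hk : us.length = k)
    (h : ∀ (i : ℕ) (hi : i < k), (Ns ⟨i, hi⟩).Returns call S us[i]) :
    (PTerm.tuple Ns).Returns call S (.tup us) := by
  subst hk
  exact returns_tuple fun i => h i i.2

theorem returns_pair {N₁ N₂ : PTerm L} {w₁ w₂ : PVal L} (h₁ : N₁.Returns call S w₁)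
    (h₂ : N₂.Returns call S w₂) : (pair N₁ N₂).Returns call S (.tuple ![w₁, w₂]) :=
  returns_tuple fun i => by fin_cases i <;> assumption

theorem returns_triple {N₁ N₂ N₃ : PTerm L} {w₁ w₂ w₃ : PVal L} (h₁ : N₁.Returns call S w₁)
    (h₂ : N₂.Returns call S w₂) (h₃ : N₃.Returns call S w₃) :
    (triple N₁ N₂ N₃).Returns call S (.tuple ![w₁, w₂, w₃]) :=
  returns_tuple fun i => by fin_cases i <;> assumption

theorem ev_pair_fail {N : PTerm L} {a : PAns L} : (pair .fail N).ev call S a ↔ a = .fail := by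
  constructor
  · rintro (⟨ws, h, rfl⟩ | ⟨i, ws, -, -, rfl⟩)
    · have h₀ : PAns.ok (ws 0) = .fail := h 0
      cases h₀
    · rfl
  · rintro rfl
    exact .inr ⟨0, fun _ => .unit, fun j hj => absurd hj (Fin.not_lt_zero j), rfl, rfl⟩

theorem returns_proj {N : PTerm L} {k : ℕ} {ws : Fin k → PVal L} (h : N.Returns call S (.tuple ws))
    (j : Fin k) : (PTerm.proj N j).Returns call S (ws j) := by
  refine fun a => (PAns.bind_iff_of_forall h a).trans
    ⟨?_, fun ha => ⟨k, ws, j.2, rfl, ha⟩⟩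
  rintro ⟨_, _, _, e, rfl⟩
  cases e
  rfl

theorem returns_proj_tup {N : PTerm L} {us : List (PVal L)} (h : N.Returns call S (.tup us))
    {j : ℕ} {w : PVal L} (hj : us[j]? = some w) : (PTerm.proj N j).Returns call S w := by
  obtain ⟨hj', rfl⟩ := List.getElem?_eq_some_iff.1 hj
  exact returns_proj h ⟨j, hj'⟩

theorem ev_letE_of_returns {N₁ N₂ : PTerm L} {x : PVar} {w : PVal L} {a : PAns L}
    (h : N₁.Returns call S w) :
    (PTerm.letE x N₁ N₂).ev call S a ↔ N₂.ev call (S.set x w) a :=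
  PAns.bind_iff_of_forall h a

theorem returns_envOf {f : Var} {us : List (PVal L)} {c : PVal L}
    (h : S (.src f) = some (.closure us c)) : (envOf f).Returns call S (.tup us) :=
  returns_proj (returns_var h) 0

theorem returns_codeOf {f : Var} {us : List (PVal L)} {c : PVal L}
    (h : S (.src f) = some (.closure us c)) : (codeOf f).Returns call S c :=
  returns_proj (returns_var h) 1

theorem returns_closure {N₁ N₂ : PTerm L} {us : List (PVal L)} {c : PVal L}
    (h₁ : N₁.Returns call S c) (h₂ : N₂.Returns call S (.tup us)) :
    (closure N₁ N₂).Returns call S (.closure us c) :=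
  returns_pair h₂ h₁

theorem returns_tupleOf {Ns : List (PTerm L)} {us : List (PVal L)}
    (h : List.Forall₂ (fun N u => N.Returns call S u) Ns us) :
    (tupleOf Ns).Returns call S (.tup us) :=
  returns_tuple_tup h.length_eq.symm fun _ hi => h.get hi (h.length_eq ▸ hi)

theorem returns_packVar {x : Var} {w : PVal L} (hx : S (.src x) = some w)
    (hw : x.ty.SameCode w w) :
    List.Forall₂ (fun N u => PTerm.Returns call N S u) (packVar x) (x.ty.comps w) := by
  unfold packVar
  obtain ⟨nm, σ⟩ := x
  rcases σ with (_ | (_ | _) | ⟨_, n, _⟩) | _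
  case n.r.ref => exact .cons (returns_var hx) .nil
  case n.fn =>
    obtain ⟨us, -, c, rfl, -, rfl, -⟩ := hw
    simp only [FTy.comps, PVal.store_closure]
    rw [List.forall₂_iff_get]
    refine ⟨by simp, fun i h₁ h₂ => ?_⟩
    simp only [List.get_eq_getElem, List.getElem_ofFn]
    exact returns_proj_tup (returns_envOf hx) (List.getElem?_eq_getElem h₂)
  all_goals exact .nil

theorem returns_pack {Γ : TEnv} {w : Var → PVal L}
    (h : ∀ x ∈ Γ, S (.src x) = some (w x) ∧ x.ty.SameCode (w x) (w x)) :
    (pack Γ).Returns call S (.tup (Γ.comps w)) := by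
  refine returns_tupleOf ?_
  induction Γ with
  | nil => exact .nil
  | cons x Γ ih =>
    obtain ⟨⟨hx, hw⟩, hΓ⟩ := List.forall_mem_cons.1 h
    exact List.rel_append (returns_packVar hx hw) (ih hΓ)

theorem ev_app_of_returns {f : PVar} {N : PTerm L} {c w : PVal L} {a : PAns L}
    (hf : S f = some c) (h : N.Returns call S w) :
    (PTerm.app f N).ev call S a ↔ call c w a := by
  refine (PAns.bind_iff_of_forall h a).trans ?_
  simp [hf]

theorem ev_split₂ {x y : PVar} {N : PTerm L} {a : PAns L} {w₁ w₂ : PVal L}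
    (hp : S .p = some (.tuple ![w₁, w₂])) (hx : .p ≠ x) :
    (split₂ x y N).ev call S a ↔ N.ev call ((S.set x w₁).set y w₂) a :=
  have hp' : (S.set x w₁) .p = some (.tuple ![w₁, w₂]) := (PEnv.set_of_ne _ hx _).trans hp
  (ev_letE_of_returns (returns_proj (returns_var hp) 0)).trans
    (ev_letE_of_returns (returns_proj (returns_var hp') 1))

theorem ev_split₃ {x y z : PVar} {N : PTerm L} {a : PAns L} {w₁ w₂ w₃ : PVal L}
    (hp : S .p = some (.tuple ![w₁, w₂, w₃])) (hx : .p ≠ x) (hy : .p ≠ y) :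
    (PTerm.letE x (.proj (.var .p) 0) (.letE y (.proj (.var .p) 1)
      (.letE z (.proj (.var .p) 2) N))).ev call S a ↔
        N.ev call (((S.set x w₁).set y w₂).set z w₃) a :=
  have hp₁ : (S.set x w₁) .p = some (.tuple ![w₁, w₂, w₃]) := (PEnv.set_of_ne _ hx _).trans hp
  have hp₂ : ((S.set x w₁).set y w₂) .p = some (.tuple ![w₁, w₂, w₃]) :=
    (PEnv.set_of_ne _ hy _).trans hp₁
  (ev_letE_of_returns (returns_proj (returns_var hp) 0)).trans
    ((ev_letE_of_returns (returns_proj (returns_var hp₁) 1)).trans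
      (ev_letE_of_returns (returns_proj (returns_var hp₂) 2)))

end PTerm

/-- `S` with the variables of `Γ` rebound to the values `w`. -/
def PEnv.rebind (S : PEnv L) (Γ : TEnv) (w : Var → PVal L) : PEnv L
  | .src x => if x ∈ Γ then some (w x) else S (.src x)
  | y => S y

theorem PEnv.rebind_of_mem {S : PEnv L} {Γ : TEnv} {w : Var → PVal L} {x : Var} (hx : x ∈ Γ) :
    S.rebind Γ w (.src x) = some (w x) :=
  if_pos hx

theorem PEnv.rebind_of_notMem {S : PEnv L} {Γ : TEnv} {w : Var → PVal L} {x : Var} (hx : x ∉ Γ) :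
    S.rebind Γ w (.src x) = S (.src x) :=
  if_neg hx

theorem PEnv.rebind_nil (S : PEnv L) (w : Var → PVal L) : S.rebind [] w = S := by
  funext y
  cases y <;> simp [PEnv.rebind]

theorem PEnv.rebind_cons (S : PEnv L) (x : Var) (Γ : TEnv) (w : Var → PVal L) :
    S.rebind (x :: Γ) w = (S.set (.src x) (w x)).rebind Γ w := by
  funext y
  cases y with
  | src z =>
    by_cases hz : z ∈ Γ
    · simp [PEnv.rebind, hz]
    · obtain rfl | hx := eq_or_ne z x
      · simp [PEnv.rebind, hz]
      · simp [PEnv.rebind, hz, hx]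
  | _ => simp [PEnv.rebind]

namespace PTerm

variable {call : PVal L → PVal L → PAns L → Prop} {S : PEnv L}

theorem ev_unpackFrom_cons {N : PTerm L} {a : PAns L} {x : Var} {Γ : TEnv} {w w₀ : PVal L}
    {pre post : List (PVal L)} (hh : S .h = some (.tup (pre ++ (x.ty.comps w ++ post))))
    (hx : S (.src x) = some w₀) (hw : x.ty.SameCode w w₀) :
    (unpackFrom N pre.length (x :: Γ)).ev call S a ↔
      (unpackFrom N (pre.length + (x.ty.comps w).length) Γ).ev call (S.set (.src x) w) a := by
  rcases hσ : x.ty with (_ | (_ | _) | ⟨_, m, _⟩) | _ <;> rw [hσ] at hw hh <;>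
    simp only [unpackFrom, hσ, FTy.comps] at hh ⊢
  case n.r.ref =>
    exact ev_letE_of_returns (returns_proj_tup (returns_var hh) (by simp))
  case n.fn =>
    obtain ⟨us, us₀, c, rfl, rfl, rfl, hlen⟩ := hw
    simp only [PVal.store_closure] at hh ⊢
    split_ifs with hm
    · obtain rfl := List.eq_nil_of_length_eq_zero hm
      obtain rfl := List.eq_nil_of_length_eq_zero (hlen.trans hm)
      rw [PEnv.set_eq_self hx, hm, Nat.add_zero]
    · refine ev_letE_of_returns (returns_closure (returns_codeOf hx) (returns_tuple_tup rfl ?_))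
      exact fun i hi => returns_proj_tup (returns_var hh) (by
        rw [List.getElem?_append_right (by omega), Nat.add_sub_cancel_left,
          List.getElem?_append_left hi, List.getElem?_eq_getElem hi])
  all_goals
    cases hw
    rw [PEnv.set_eq_self hx, List.length_nil, Nat.add_zero]

theorem ev_unpackFrom {N : PTerm L} {a : PAns L} {w : Var → PVal L} {pre post : List (PVal L)}
    {Γ : TEnv} (hΓ : Γ.Nodup) (hh : S .h = some (.tup (pre ++ (Γ.comps w ++ post))))
    (hw : ∀ x ∈ Γ, ∃ w₀, S (.src x) = some w₀ ∧ x.ty.SameCode (w x) w₀) :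
    (unpackFrom N pre.length Γ).ev call S a ↔ N.ev call (S.rebind Γ w) a := by
  induction Γ generalizing pre S with
  | nil => rw [PEnv.rebind_nil, unpackFrom]
  | cons x Γ ih =>
    obtain ⟨hxΓ, hΓ⟩ := List.nodup_cons.1 hΓ
    obtain ⟨⟨w₀, hx, hxw⟩, hw⟩ := List.forall_mem_cons.1 hw
    simp only [TEnv.comps, List.flatMap_cons, List.append_assoc] at hh
    rw [ev_unpackFrom_cons hh hx hxw, PEnv.rebind_cons, ← List.length_append]
    refine ih hΓ (by simpa [TEnv.comps] using hh) fun y hy => ?_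
    rw [PEnv.set_of_ne _ (by rintro ⟨⟩; exact hxΓ hy)]
    exact hw y hy

theorem ev_unpack {N : PTerm L} {a : PAns L} {w : Var → PVal L} {post : List (PVal L)}
    {Γ : TEnv} (hΓ : Γ.Nodup) (hh : S .h = some (.tup (Γ.comps w ++ post)))
    (hw : ∀ x ∈ Γ, ∃ w₀, S (.src x) = some w₀ ∧ x.ty.SameCode (w x) w₀) :
    (unpack Γ N).ev call S a ↔ N.ev call (S.rebind Γ w) a :=
  ev_unpackFrom (pre := []) hΓ hh hw

end PTerm

/-! ### Properties of the typing rules -/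

theorem NTEnv.exists_ty_of_mem {Δ : NTEnv} {x : Var} (hx : x ∈ Δ.toTEnv) : ∃ τ, x.ty = .n τ := by
  obtain ⟨p, -, rfl⟩ := List.mem_map.1 hx
  exact ⟨p.2, rfl⟩

theorem Tr.wf {Γ Γ' : TEnv} {M : Term L} {τ : NTy} {N : PTerm L} (h : Tr Γ M τ Γ' N) : Γ.WF := by
  induction h <;> assumption

theorem TEnv.mem_erase {Γ : TEnv} {x y : Var} : y ∈ TEnv.erase Γ x ↔ y ∈ Γ ∧ y ≠ x := by
  simp [TEnv.erase]

theorem TEnv.excTy_sublist (Γ : TEnv) (x : Var) (σ : FTy) : (Γ.excTy x σ).Sublist Γ := by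
  unfold TEnv.excTy
  split
  exacts [.refl Γ, List.filter_sublist]

theorem TEnv.mem_excTy {Γ : TEnv} {x y : Var} {σ : FTy} :
    y ∈ Γ.excTy x σ ↔ y ∈ Γ ∧ (σ.sharable ∨ y ≠ x) := by
  unfold TEnv.excTy
  split <;> simp_all [TEnv.mem_erase]

theorem TEnv.eq_erase_append {Γ Γ' : TEnv} {x : Var} (hx : x ∉ Γ) (h : Γ'.Sublist (Γ ++ [x])) :
    (Γ'.erase x).Sublist Γ ∧ ∃ Γ₁, Γ' = Γ'.erase x ++ Γ₁ := by
  obtain ⟨A, B, rfl, hA, hB⟩ := List.sublist_append_iff.1 h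
  have hA' : TEnv.erase A x = A :=
    List.filter_eq_self.2 fun y hy => by
      simpa using fun e : y = x => hx (e ▸ hA.subset hy)
  have hB' : TEnv.erase B x = [] :=
    List.filter_eq_nil_iff.2 fun y hy => by simpa using hB.subset hy
  have : TEnv.erase (A ++ B) x = A :=
    calc TEnv.erase (A ++ B) x = TEnv.erase A x ++ TEnv.erase B x := List.filter_append ..
      _ = A := by rw [hA', hB', List.append_nil]
  rw [this]
  exact ⟨hA, B, rfl⟩

theorem TEnv.WF.notMem {Γ : TEnv} {x : Var} (h : (Γ ++ [x]).WF) : x ∉ Γ :=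
  fun hx => List.disjoint_of_nodup_append h.1 hx (List.mem_singleton_self x)

theorem Tr.sublist {Γ Γ' : TEnv} {M : Term L} {τ : NTy} {N : PTerm L} (h : Tr Γ M τ Γ' N) :
    Γ'.Sublist Γ := by
  induction h with
  | fail | unit | const | op | app | rapp => exact .refl _
  | var | deref | mkref | assign => exact TEnv.excTy_sublist _ _ _
  | letE _ _ h₂ ih₁ ih₂ => exact (TEnv.eq_erase_append h₂.wf.notMem ih₂).1.trans ih₁
  | ite _ _ _ ih₁ _ => exact ih₁
  | lam _ _ _ hs | fix _ _ _ _ hs =>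
    obtain ⟨-, rfl⟩ := Prod.mk.inj hs
    exact List.filter_sublist

theorem RTy.cellSize_eq_one (ρ : RTy) : ρ.cellSize = 1 := by
  induction ρ with
  | base => rfl
  | ref _ ih => exact ih

theorem NTy.size_eq_zero_of_sharable {τ : NTy} (h : (FTy.n τ).sharable) : τ.size = 0 := by
  rcases τ with _ | (_ | _) | ⟨_, _ | m, _⟩ <;> simp_all [FTy.sharable, NTy.size]

theorem NTEnv.length_comps {Δ : NTEnv} {w : Var → PVal L}
    (h : ∀ x ∈ Δ.toTEnv, ∀ τ, x.ty = .n τ → (x.ty.comps (w x)).length = τ.size) :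
    (Δ.toTEnv.comps w).length = Δ.size := by
  simp only [TEnv.comps, List.length_flatMap, NTEnv.toTEnv, List.map_map, NTEnv.size]
  congr 1
  refine List.map_congr_left fun p hp => ?_
  exact h _ (List.mem_map_of_mem hp) p.2 rfl

/-! ### Representation of source values -/

/-- A source value `src`, a target value `tgt` meant to represent it, and the set `own` of the
locations that `src` owns. In the target, the contents of these locations are part of `tgt`. -/
structure Rep (L : Lang) where
  src : Val L
  tgt : PVal L
  own : Set ℕ

/-- Assignments of representations to the variables. -/
abbrev Reps (L : Lang) := Var → Rep L

/-- `θ{x ↦ β}`. -/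
def Reps.set (θ : Reps L) (x : Var) (β : Rep L) : Reps L := Function.update θ x β

/-- The target values assigned by `θ`. -/
def Reps.tgt (θ : Reps L) (x : Var) : PVal L := (θ x).tgt

@[simp]
theorem Reps.set_self (θ : Reps L) (x : Var) (β : Rep L) : θ.set x β x = β := by
  simp [Reps.set]

@[simp]
theorem Reps.set_of_ne (θ : Reps L) {x y : Var} (h : y ≠ x) (β : Rep L) :
    θ.set x β y = θ y := by
  simp [Reps.set, h]

/-- All locations owned by the variables of `Γ`. -/
def footprint (Γ : TEnv) (θ : Reps L) : Set ℕ := {ℓ | ∃ x ∈ Γ, ℓ ∈ (θ x).own}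

/-- Different variables of `Γ` own disjoint sets of locations. -/
def Separate (Γ : TEnv) (θ : Reps L) : Prop :=
  ∀ x ∈ Γ, ∀ y ∈ Γ, x ≠ y → Disjoint (θ x).own (θ y).own

/-- The environments `R` and `S` bind the variables of `Δ` as `θ` does, but for the store
components in `S`, which are out of date: they are those from the time of the capture. -/
def Captures (Δ : NTEnv) (R : Env L) (S : PEnv L) (θ : Reps L) : Prop :=
  ∀ x ∈ Δ.toTEnv, R x = some (θ x).src ∧ ∃ w₀, S (.src x) = some w₀ ∧ x.ty.SameCode (θ x).tgt w₀

/-- The body of the code of a translated function with captured environment `Δ`, whose source body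
is translated to `N` in the environment `Θ`. -/
def funBody (Δ Θ : TEnv) (x : Var) (N : PTerm L) : PTerm L :=
  split₂ (.src x) .h (unpack Δ (letPair .r .h N
    (unpack Θ (triple (.var .r) (v x) (pack Δ)))))

/-- `FunRel τ₁ Δ τ₂ θ u c`: the code `c` is a translation of the function value `u`, and both have
captured the variables of `Δ`, with the values in `θ`. -/
inductive FunRel (τ₁ : NTy) (Δ : NTEnv) (τ₂ : NTy) (θ : Reps L) : Val L → PVal L → Prop
  | lam {x M N R S} (hx : x.ty = .n τ₁) (h : Tr (Δ.toTEnv ++ [x]) M τ₂ (Δ.toTEnv ++ [x]) N)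
      (hRS : Captures Δ R S θ) :
      FunRel τ₁ Δ τ₂ θ (.clos x M R) (.clos .p (funBody Δ.toTEnv (Δ.toTEnv ++ [x]) x N) S)
  | fix {f x M N R S} (hf : f.ty = .rfun τ₁ Δ τ₂) (hx : x.ty = .n τ₁)
      (h : Tr (Δ.toTEnv ++ [f, x]) M τ₂ (Δ.toTEnv ++ [f, x]) N) (hRS : Captures Δ R S θ) :
      FunRel τ₁ Δ τ₂ θ (.rclos f x M R)
        (.rclos (.src f) .p (funBody Δ.toTEnv (Δ.toTEnv ++ [f, x]) x N) S)

/-- `β.Valid H τ`: in the heap `H`, the source value of `β`, of type `τ`, owns the locations of `β`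
and is represented by the target value of `β`. -/
inductive Rep.Valid (H : Heap L) : NTy → Rep L → Prop
  | unit : Valid H .unit ⟨.atom .unit, .unit, ∅⟩
  | const (c : L.base.Carrier) : Valid H .b ⟨.atom (.const c), .const c, ∅⟩
  | ref {ρ ℓ a w F} (hℓ : H ℓ = some a) (h : Valid H (.r ρ) ⟨.atom a, w, F⟩) (hF : ℓ ∉ F) :
      Valid H (.r (.ref ρ)) ⟨.atom (.loc ℓ), w, insert ℓ F⟩
  | fn {τ₁ τ₂ Δ u c θ} (hu : FunRel τ₁ Δ τ₂ θ u c)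
      (hΔ : ∀ x ∈ Δ.toTEnv, ∀ τ, x.ty = .n τ → Valid H τ (θ x)) (hsep : Separate Δ.toTEnv θ) :
      Valid H (.fn τ₁ Δ.size τ₂) ⟨u, .closure (Δ.toTEnv.comps θ.tgt) c, footprint Δ.toTEnv θ⟩

/-- `Rep.Valid` extended to full types. A recursive function owns no locations; how its value is
represented is a matter of `FunsRel`, since it depends on the values of other variables. -/
def Rep.ValidAt (H : Heap L) : FTy → Rep L → Prop
  | .n τ, β => β.Valid H τ
  | .rfun .., β => β.own = ∅

/-- `β` and `β'` have the same source value, and the same target value but for store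
components. -/
def Rep.SameUpToStore (σ : FTy) (β β' : Rep L) : Prop :=
  β.src = β'.src ∧ σ.SameCode β.tgt β'.tgt

theorem Rep.SameUpToStore.trans {σ : FTy} {β₁ β₂ β₃ : Rep L} (h : β₁.SameUpToStore σ β₂)
    (h' : β₂.SameUpToStore σ β₃) : β₁.SameUpToStore σ β₃ :=
  ⟨h.1.trans h'.1, h.2.trans h'.2⟩

theorem FunRel.congr {τ₁ τ₂ : NTy} {Δ : NTEnv} {θ θ' : Reps L} {u : Val L} {c : PVal L}
    (h : FunRel τ₁ Δ τ₂ θ u c) (hθ : ∀ x ∈ Δ.toTEnv, (θ' x).SameUpToStore x.ty (θ x)) :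
    FunRel τ₁ Δ τ₂ θ' u c := by
  have hcap {R : Env L} {S : PEnv L} (hRS : Captures Δ R S θ) : Captures Δ R S θ' := by
    intro x hx
    obtain ⟨hR, w₀, hS, hw⟩ := hRS x hx
    exact ⟨(hθ x hx).1 ▸ hR, w₀, hS, (hθ x hx).2.trans hw⟩
  cases h with
  | lam hx h hRS => exact .lam hx h (hcap hRS)
  | fix hf hx h hRS => exact .fix hf hx h (hcap hRS)

namespace Rep

variable {H H' : Heap L} {τ : NTy} {σ : FTy} {β : Rep L}

theorem Valid.ne_none (h : β.Valid H τ) : ∀ ℓ ∈ β.own, H ℓ ≠ none := by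
  induction h with
  | unit | const => simp
  | ref hℓ _ _ ih =>
    rintro ℓ (rfl | hm)
    · simp [hℓ]
    · exact ih ℓ hm
  | fn _ _ _ ih =>
    rintro ℓ ⟨x, hx, hm⟩
    obtain ⟨τ, hτ⟩ := NTEnv.exists_ty_of_mem hx
    exact ih x hx τ hτ ℓ hm

theorem Valid.congr_heap (h : β.Valid H τ) (hH : ∀ ℓ ∈ β.own, H' ℓ = H ℓ) : β.Valid H' τ := by
  induction h with
  | unit => exact .unit
  | const c => exact .const c
  | ref hℓ _ hF ih => exact .ref ((hH _ (.inl rfl)).trans hℓ) (ih fun ℓ hm => hH ℓ (.inr hm)) hF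
  | fn hu _ hsep ih =>
    exact .fn hu (fun x hx τ hτ => ih x hx τ hτ fun ℓ hm => hH ℓ ⟨x, hx, hm⟩) hsep

theorem Valid.length_comps (h : β.Valid H τ) : ((FTy.n τ).comps β.tgt).length = τ.size := by
  induction h with
  | unit | const => rfl
  | ref => simp [FTy.comps, NTy.size, RTy.cellSize_eq_one]
  | fn _ _ _ ih =>
    simp only [FTy.comps, PVal.store_closure, NTy.size]
    exact NTEnv.length_comps fun x hx τ hτ => hτ ▸ ih x hx τ hτ

theorem Valid.sameCode (h : β.Valid H τ) : (FTy.n τ).SameCode β.tgt β.tgt := by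
  have hl := h.length_comps
  cases h with
  | unit | const => exact Eq.refl _
  | ref => trivial
  | fn =>
    simp only [FTy.comps, PVal.store_closure] at hl
    exact ⟨_, _, _, rfl, rfl, hl, hl⟩

theorem Valid.own_eq_empty (h : β.Valid H τ) (hτ : τ.size = 0) : β.own = ∅ := by
  induction h with
  | unit | const => rfl
  | ref => simp [NTy.size, RTy.cellSize_eq_one] at hτ
  | fn _ _ _ ih =>
    refine Set.eq_empty_iff_forall_notMem.2 ?_
    rintro ℓ ⟨x, hx, hm⟩
    obtain ⟨p, hp, rfl⟩ := List.mem_map.1 hx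
    have h0 : p.2.size = 0 := List.sum_eq_zero_iff.1 hτ _ (List.mem_map_of_mem hp)
    rw [ih _ hx p.2 rfl h0] at hm
    exact hm

theorem Valid.exists_of_ref {ρ : RTy} (h : β.Valid H (.r (.ref ρ))) :
    ∃ ℓ a F, β = ⟨.atom (.loc ℓ), β.tgt, insert ℓ F⟩ ∧ H ℓ = some a ∧
      Valid H (.r ρ) ⟨.atom a, β.tgt, F⟩ ∧ ℓ ∉ F := by
  cases h with
  | ref hℓ h hF => exact ⟨_, _, _, rfl, hℓ, h, hF⟩

theorem Valid.exists_atom {ρ : RTy} (h : β.Valid H (.r ρ)) : ∃ a, β.src = .atom a := by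
  cases h <;> exact ⟨_, rfl⟩

theorem Valid.exists_const (h : β.Valid H .b) :
    ∃ c, β.src = .atom (.const c) ∧ β.tgt = .const c := by
  cases h
  exact ⟨_, rfl, rfl⟩

theorem ValidAt.ne_none (h : β.ValidAt H σ) : ∀ ℓ ∈ β.own, H ℓ ≠ none := by
  cases σ with
  | n τ => exact Valid.ne_none h
  | rfun =>
    have : β.own = ∅ := h
    simp [this]

theorem ValidAt.congr_heap (h : β.ValidAt H σ) (hH : ∀ ℓ ∈ β.own, H' ℓ = H ℓ) :
    β.ValidAt H' σ := by
  cases σ with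
  | n τ => exact Valid.congr_heap h hH
  | rfun => exact h

theorem ValidAt.sameCode (h : β.ValidAt H σ) : σ.SameCode β.tgt β.tgt := by
  cases σ with
  | n τ => exact Valid.sameCode h
  | rfun => exact Eq.refl _

theorem ValidAt.own_eq_empty (h : β.ValidAt H σ) (hσ : σ.sharable) : β.own = ∅ := by
  cases σ with
  | n τ => exact Valid.own_eq_empty h (NTy.size_eq_zero_of_sharable hσ)
  | rfun => exact h

end Rep

/-- In the heap `H`, the variables of `Γ` have valid representations in `θ` and own disjoint sets
of locations. -/
structure Stored (H : Heap L) (Γ : TEnv) (θ : Reps L) : Prop where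
  valid : ∀ x ∈ Γ, (θ x).ValidAt H x.ty
  sep : Separate Γ θ

/-- The recursive functions of `Γ` are represented in `θ` by code for them, and have captured
variables whose values are those in `θ`. -/
def FunsRel (Γ : TEnv) (θ : Reps L) : Prop :=
  ∀ f ∈ Γ, ∀ τ₁ Δ τ₂, f.ty = .rfun τ₁ Δ τ₂ → FunRel τ₁ Δ τ₂ θ (θ f).src (θ f).tgt

theorem FunsRel.of_normal {Γ : TEnv} (θ : Reps L) (h : ∀ x ∈ Γ, ∃ τ, x.ty = .n τ) :
    FunsRel Γ θ := by
  intro f hf τ₁ Δ τ₂ hσ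
  obtain ⟨τ, hτ⟩ := h f hf
  cases hσ.symm.trans hτ

section footprint

variable {Γ Γ' : TEnv} {θ θ' : Reps L}

theorem footprint_mono (h : Γ' ⊆ Γ) (θ : Reps L) : footprint Γ' θ ⊆ footprint Γ θ :=
  fun _ ⟨x, hx, hℓ⟩ => ⟨x, h hx, hℓ⟩

theorem subset_footprint {x : Var} (hx : x ∈ Γ) (θ : Reps L) : (θ x).own ⊆ footprint Γ θ :=
  fun _ hℓ => ⟨x, hx, hℓ⟩

theorem footprint_congr (h : ∀ x ∈ Γ, θ' x = θ x) : footprint Γ θ' = footprint Γ θ := by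
  ext ℓ
  exact exists_congr fun x => and_congr_right fun hx => by rw [h x hx]

theorem disjoint_footprint {A : Set ℕ} :
    Disjoint A (footprint Γ θ) ↔ ∀ x ∈ Γ, Disjoint A (θ x).own := by
  simp only [Set.disjoint_right, footprint, Set.mem_ofPred_eq]
  exact ⟨fun h x hx ℓ hℓ => h ⟨x, hx, hℓ⟩, fun h ℓ ⟨x, hx, hℓ⟩ => h x hx hℓ⟩

theorem footprint_append (Γ Γ' : TEnv) (θ : Reps L) :
    footprint (Γ ++ Γ') θ = footprint Γ θ ∪ footprint Γ' θ := by
  ext ℓ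
  simp [footprint, or_and_right, exists_or]

theorem footprint_singleton (x : Var) (θ : Reps L) : footprint [x] θ = (θ x).own := by
  simp [footprint]

theorem footprint_nil (θ : Reps L) : footprint [] θ = ∅ := by
  simp [footprint]

theorem footprint_append_set {x : Var} (hx : x ∉ Γ) (β : Rep L) :
    footprint (Γ ++ [x]) (θ.set x β) = footprint Γ θ ∪ β.own := by
  rw [footprint_append, footprint_singleton, Reps.set_self,
    footprint_congr fun y hy => θ.set_of_ne (ne_of_mem_of_not_mem hy hx) β]

end footprint

namespace Stored

variable {H : Heap L} {Γ Γ' : TEnv} {θ θ' : Reps L}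

theorem nil (H : Heap L) (θ : Reps L) : Stored H [] θ :=
  ⟨by simp, by simp [Separate]⟩

theorem subset (h : Stored H Γ θ) (hΓ : Γ' ⊆ Γ) : Stored H Γ' θ :=
  ⟨fun x hx => h.valid x (hΓ hx), fun x hx y hy => h.sep x (hΓ hx) y (hΓ hy)⟩

theorem congr (h : Stored H Γ θ) (hθ : ∀ x ∈ Γ, θ' x = θ x) : Stored H Γ θ' :=
  ⟨fun x hx => hθ x hx ▸ h.valid x hx,
    fun x hx y hy hne => hθ x hx ▸ hθ y hy ▸ h.sep x hx y hy hne⟩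

theorem validAt (h : Stored H Γ θ) {x : Var} {σ : FTy} (hx : Γ.Has x σ) : (θ x).ValidAt H σ :=
  hx.2 ▸ h.valid x hx.1

theorem set_append (h : Stored H Γ θ) {x : Var} (hx : x ∉ Γ) {β : Rep L}
    (hβ : β.ValidAt H x.ty) (hdisj : ∀ y ∈ Γ, Disjoint β.own (θ y).own) :
    Stored H (Γ ++ [x]) (θ.set x β) := by
  have hold {y : Var} (hy : y ∈ Γ) : θ.set x β y = θ y :=
    θ.set_of_ne (ne_of_mem_of_not_mem hy hx) β
  refine ⟨List.forall_mem_append.2 ⟨fun y hy => hold hy ▸ h.valid y hy, by simpa using hβ⟩, ?_⟩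
  intro y hy z hz hne
  rcases List.mem_append.1 hy with hy' | hy' <;> rcases List.mem_append.1 hz with hz' | hz'
  · rw [hold hy', hold hz']
    exact h.sep y hy' z hz' hne
  · rw [List.mem_singleton.1 hz', Reps.set_self, hold hy']
    exact (hdisj y hy').symm
  · rw [List.mem_singleton.1 hy', Reps.set_self, hold hz']
    exact hdisj z hz'
  · exact absurd ((List.mem_singleton.1 hy').trans (List.mem_singleton.1 hz').symm) hne

theorem disjoint_footprint (h : Stored H Γ θ) {x : Var} (hx : x ∈ Γ) {T : TEnv} (hT : T ⊆ Γ)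
    (hxT : x ∉ T) : Disjoint (footprint T θ) (θ x).own :=
  (LinRef.disjoint_footprint.2 fun y hy =>
    h.sep x hx y (hT hy) fun e => hxT (e ▸ hy)).symm

theorem disjoint_excTy (h : Stored H Γ θ) {x : Var} (hx : x ∈ Γ) {σ : FTy} {A : Set ℕ}
    (hA : A ⊆ (θ x).own) (hσ : σ.sharable → A = ∅) :
    ∀ y ∈ Γ.excTy x σ, Disjoint A (θ y).own := by
  intro y hy
  obtain ⟨hyΓ, hs | hne⟩ := TEnv.mem_excTy.1 hy
  · simp [hσ hs]
  · exact (h.sep x hx y hyΓ hne.symm).mono_left hA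

theorem valid_fn {τ₁ τ₂ : NTy} {Δ : NTEnv} {u : Val L} {c : PVal L}
    (h : Stored H Δ.toTEnv θ) (hu : FunRel τ₁ Δ τ₂ θ u c) :
    Rep.Valid H (.fn τ₁ Δ.size τ₂)
      ⟨u, .closure (Δ.toTEnv.comps θ.tgt) c, footprint Δ.toTEnv θ⟩ :=
  .fn hu (fun _ hx _ hτ => h.validAt ⟨hx, hτ⟩) h.sep

end Stored

theorem Rep.Valid.exists_of_fn {H : Heap L} {τ₁ τ₂ : NTy} {m : ℕ} {β : Rep L}
    (h : β.Valid H (.fn τ₁ m τ₂)) :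
    ∃ (Δ : NTEnv) (θ : Reps L) (c : PVal L), m = Δ.size ∧
      β = ⟨β.src, .closure (Δ.toTEnv.comps θ.tgt) c, footprint Δ.toTEnv θ⟩ ∧
      FunRel τ₁ Δ τ₂ θ β.src c ∧ Stored H Δ.toTEnv θ := by
  cases h with
  | @fn _ _ Δ u c θ hu hΔ hsep =>
    refine ⟨Δ, θ, c, rfl, rfl, hu, fun x hx => ?_, hsep⟩
    obtain ⟨τ, hτ⟩ := NTEnv.exists_ty_of_mem hx
    rw [hτ]
    exact hΔ x hx τ hτ

/-! ### Evolution of the heap -/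

/-- Only finitely many locations are in use. -/
def Heap.IsFinite (H : Heap L) : Prop := {ℓ | H ℓ ≠ none}.Finite

theorem Heap.IsFinite.exists_fresh {H : Heap L} (h : H.IsFinite) : ∃ ℓ, H ℓ = none := by
  obtain ⟨ℓ, hℓ⟩ := h.exists_notMem
  exact ⟨ℓ, by simpa using hℓ⟩

theorem Heap.IsFinite.set {H : Heap L} (h : H.IsFinite) (ℓ : ℕ) (a : Atom L) :
    (H.set ℓ a).IsFinite := by
  refine (h.insert ℓ).subset fun m hm => ?_
  by_cases e : m = ℓ
  · exact .inl e
  · exact .inr (by simpa [Heap.set, e] using hm)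

theorem Rep.Valid.ref_set {H : Heap L} {ρ : RTy} {β : Rep L} (h : β.Valid H (.r ρ)) {a : Atom L}
    (ha : β.src = .atom a) {ℓ : ℕ} (hℓ : ℓ ∉ β.own) :
    Valid (H.set ℓ a) (.r (.ref ρ)) ⟨.atom (.loc ℓ), β.tgt, insert ℓ β.own⟩ := by
  refine .ref (Function.update_self ..) (ha ▸ h.congr_heap fun m hm => ?_) hℓ
  exact Function.update_of_ne (ne_of_mem_of_not_mem hm hℓ) _ _

/-- From `H` to `H'` only the locations in `A` have changed, and `B` consists of locations in `A`
or new ones. -/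
structure Frame (H H' : Heap L) (A B : Set ℕ) : Prop where
  eq : ∀ ℓ ∉ A, H ℓ ≠ none → H' ℓ = H ℓ
  sub : ∀ ℓ ∈ B, ℓ ∈ A ∨ H ℓ = none

namespace Frame

variable {H H₁ H₂ : Heap L} {A A' B B' C : Set ℕ}

theorem refl (H : Heap L) (A : Set ℕ) : Frame H H A A :=
  ⟨fun _ _ _ => rfl, fun _ => .inl⟩

theorem heap_set {ℓ : ℕ} (hℓ : ℓ ∈ A ∨ H ℓ = none) (hB : B ⊆ insert ℓ A) (a : Atom L) :
    Frame H (H.set ℓ a) A B := by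
  refine ⟨fun m hA hm => Function.update_of_ne ?_ _ _, fun m hm => ?_⟩
  · rintro rfl
    exact hℓ.elim hA hm
  · obtain rfl | hA := hB hm
    exacts [hℓ, .inl hA]

theorem trans (h : Frame H H₁ A B) (h' : Frame H₁ H₂ B C) : Frame H H₂ A C := by
  refine ⟨fun ℓ hA hH => ?_, fun ℓ hC => ?_⟩
  · have e := h.eq ℓ hA hH
    rw [← e]
    refine h'.eq ℓ (fun hB => ?_) (e ▸ hH)
    exact (h.sub ℓ hB).elim hA hH
  · by_contra! hc
    rcases h'.sub ℓ hC with hB | hn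
    · exact (h.sub ℓ hB).elim hc.1 hc.2
    · exact hc.2 ((h.eq ℓ hc.1 hc.2).symm.trans hn)

theorem mono (h : Frame H H₁ A B) (hA : A ⊆ A') (hB : B' ⊆ B) : Frame H H₁ A' B' :=
  ⟨fun ℓ hℓ => h.eq ℓ fun hm => hℓ (hA hm), fun ℓ hℓ => (h.sub ℓ (hB hℓ)).imp_left (@hA ℓ)⟩

theorem disjoint (h : Frame H H₁ A B) (hC : ∀ ℓ ∈ C, H ℓ ≠ none) (hA : Disjoint A C) :
    Disjoint B C :=
  Set.disjoint_left.2 fun ℓ hB hℓ =>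
    (h.sub ℓ hB).elim (fun hm => Set.disjoint_left.1 hA hm hℓ) (hC ℓ hℓ)

end Frame

theorem Rep.ValidAt.frame {H H' : Heap L} {A B : Set ℕ} {σ : FTy} {β : Rep L}
    (h : β.ValidAt H σ) (hf : Frame H H' A B) (hA : Disjoint A β.own) : β.ValidAt H' σ :=
  h.congr_heap fun ℓ hℓ => hf.eq ℓ (Set.disjoint_right.1 hA hℓ) (h.ne_none ℓ hℓ)

/-- `Evolves H A θ H' G Γ θ'`: a computation that has access to the locations in `A` has changed the
heap `H` to `H'`; it has produced a result that owns `G`, and changed the representations of the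
variables of `Γ` from `θ` to `θ'`. Everything owned afterwards is in `A` or newly allocated. -/
structure Evolves (H : Heap L) (A : Set ℕ) (θ : Reps L) (H' : Heap L) (G : Set ℕ) (Γ : TEnv)
    (θ' : Reps L) : Prop where
  fin : H'.IsFinite
  store : Stored H' Γ θ'
  same : ∀ x ∈ Γ, (θ' x).SameUpToStore x.ty (θ x)
  disj : ∀ x ∈ Γ, Disjoint G (θ' x).own
  frame : Frame H H' A (G ∪ footprint Γ θ')

namespace Evolves

variable {H H' H₁ H₂ : Heap L} {A G G₁ G₂ : Set ℕ} {Γ Γ' Γ₁ Γ₂ T : TEnv} {θ θ' θ₁ θ₁' θ₂ : Reps L}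

theorem nil (hfin : H'.IsFinite) (h : Frame H H' A G) : Evolves H A θ H' G [] θ' :=
  ⟨hfin, .nil H' θ', by simp, by simp, by rwa [footprint_nil, Set.union_empty]⟩

theorem subset (h : Evolves H A θ H' G Γ θ') (hΓ : Γ' ⊆ Γ) : Evolves H A θ H' G Γ' θ' :=
  ⟨h.fin, h.store.subset hΓ, fun x hx => h.same x (hΓ hx), fun x hx => h.disj x (hΓ hx),
    h.frame.mono subset_rfl (Set.union_subset_union_right G (footprint_mono hΓ θ'))⟩

theorem congr (h : Evolves H A θ H' G Γ θ₁) (hθ : ∀ x ∈ Γ, θ' x = θ₁ x) :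
    Evolves H A θ H' G Γ θ' :=
  ⟨h.fin, h.store.congr hθ, fun x hx => hθ x hx ▸ h.same x hx, fun x hx => hθ x hx ▸ h.disj x hx,
    footprint_congr hθ ▸ h.frame⟩

theorem set_append {x : Var} {β : Rep L} (h : Evolves H A θ H' (G ∪ β.own) Γ θ') (hx : x ∉ Γ)
    (hβ : β.ValidAt H' x.ty) (hG : Disjoint G β.own) (hs : β.SameUpToStore x.ty (θ x)) :
    Evolves H A θ H' G (Γ ++ [x]) (θ'.set x β) := by
  have hold {y : Var} (hy : y ∈ Γ) : θ'.set x β y = θ' y :=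
    θ'.set_of_ne (ne_of_mem_of_not_mem hy hx) β
  refine ⟨h.fin, h.store.set_append hx hβ fun y hy => (Set.disjoint_union_left.1 (h.disj y hy)).2,
    List.forall_mem_append.2 ⟨fun y hy => hold hy ▸ h.same y hy, by simpa using hs⟩,
    List.forall_mem_append.2 ⟨fun y hy => ?_, by simpa using hG⟩, ?_⟩
  · exact hold hy ▸ (Set.disjoint_union_left.1 (h.disj y hy)).1
  · rw [footprint_append_set hx, Set.union_comm (footprint Γ θ'), ← Set.union_assoc]
    exact h.frame

theorem frame_rule (h : Evolves H A θ H' G T θ') (hΓ : Stored H Γ θ) (hA : A ⊆ footprint Γ θ)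
    (hT : ∀ x ∈ Γ', x ∉ T → x ∈ Γ ∧ θ' x = θ x ∧ Disjoint A (θ x).own) :
    Evolves H (footprint Γ θ) θ H' G Γ' θ' := by
  have hnew {x : Var} (hx : x ∈ Γ') (hxT : x ∉ T) :
      Disjoint (G ∪ footprint T θ') (θ' x).own := by
    obtain ⟨hxΓ, e, hd⟩ := hT x hx hxT
    exact e ▸ h.frame.disjoint (hΓ.valid x hxΓ).ne_none hd
  have hsep {x y : Var} (hx : x ∈ T) (hy : y ∈ Γ') (hyT : y ∉ T) :
      Disjoint (θ' x).own (θ' y).own :=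
    (hnew hy hyT).mono_left (Set.subset_union_of_subset_right (subset_footprint hx θ') G)
  refine ⟨h.fin, ⟨fun x hx => ?_, fun x hx y hy hne => ?_⟩, fun x hx => ?_, fun x hx => ?_,
    ⟨fun ℓ hℓ => h.frame.eq ℓ fun hm => hℓ (hA hm), ?_⟩⟩
  · by_cases hxT : x ∈ T
    · exact h.store.valid x hxT
    · obtain ⟨hxΓ, e, hd⟩ := hT x hx hxT
      exact e ▸ (hΓ.valid x hxΓ).frame h.frame hd
  · by_cases hxT : x ∈ T <;> by_cases hyT : y ∈ T
    · exact h.store.sep x hxT y hyT hne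
    · exact hsep hxT hy hyT
    · exact (hsep hyT hx hxT).symm
    · rw [(hT x hx hxT).2.1, (hT y hy hyT).2.1]
      exact hΓ.sep x (hT x hx hxT).1 y (hT y hy hyT).1 hne
  · by_cases hxT : x ∈ T
    · exact h.same x hxT
    · obtain ⟨hxΓ, e, -⟩ := hT x hx hxT
      rw [e]
      exact ⟨rfl, (hΓ.valid x hxΓ).sameCode⟩
  · by_cases hxT : x ∈ T
    · exact h.disj x hxT
    · exact (hnew hx hxT).mono_left Set.subset_union_left
  · rintro ℓ (hm | ⟨x, hx, hm⟩)
    · exact (h.frame.sub ℓ (.inl hm)).imp_left (@hA ℓ)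
    · by_cases hxT : x ∈ T
      · exact (h.frame.sub ℓ (.inr ⟨x, hxT, hm⟩)).imp_left (@hA ℓ)
      · obtain ⟨hxΓ, e, -⟩ := hT x hx hxT
        exact .inl ⟨x, hxΓ, e ▸ hm⟩

theorem of_frame (hfin : H'.IsFinite) (h : Frame H H' A G) (hΓ : Stored H Γ θ)
    (hA : A ⊆ footprint Γ θ) (hΓ' : ∀ x ∈ Γ', x ∈ Γ ∧ Disjoint A (θ x).own) :
    Evolves H (footprint Γ θ) θ H' G Γ' θ :=
  (nil hfin h).frame_rule hΓ hA fun x hx _ => ⟨(hΓ' x hx).1, rfl, (hΓ' x hx).2⟩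

theorem trans (h₁ : Evolves H A θ H₁ G₁ Γ₁ θ₁)
    (h₂ : Evolves H₁ (G₁ ∪ footprint Γ₁ θ₁) θ₁' H₂ G₂ Γ₂ θ₂)
    (hΓ : ∀ x ∈ Γ₂, x ∈ Γ₁ ∧ θ₁' x = θ₁ x) : Evolves H A θ H₂ G₂ Γ₂ θ₂ := by
  refine ⟨h₂.fin, h₂.store, fun x hx => ?_, h₂.disj, h₁.frame.trans h₂.frame⟩
  obtain ⟨hx₁, e⟩ := hΓ x hx
  exact (e ▸ h₂.same x hx).trans (h₁.same x hx₁)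

end Evolves

/-! ### Simulation -/

/-- Both answers are `FAIL`, or both are values and `Q` holds. -/
inductive AnsRel (Q : Val L → Env L → Heap L → PVal L → Prop) : Ans L → PAns L → Prop
  | ok {v R H w} (h : Q v R H w) : AnsRel Q (.ok v R H) (.ok w)
  | fail : AnsRel Q .fail .fail

/-- Every answer in `E` is matched by one in `P`, and conversely. Both directions are needed, as
evaluation is not deterministic: `mkref` may choose any fresh location. -/
def Sim (E : Ans L → Prop) (P : PAns L → Prop) (Q : Val L → Env L → Heap L → PVal L → Prop) :
    Prop :=
  (∀ a, E a → ∃ p, P p ∧ AnsRel Q a p) ∧ ∀ p, P p → ∃ a, E a ∧ AnsRel Q a p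

namespace Sim

variable {E E' : Ans L → Prop} {P P' : PAns L → Prop}
  {Q Q' : Val L → Env L → Heap L → PVal L → Prop}

theorem congr (h : Sim E P Q) (hE : ∀ a, E' a ↔ E a) (hP : ∀ p, P' p ↔ P p) : Sim E' P' Q := by
  simpa only [Sim, hE, hP] using h

theorem of_unique {p : PAns L} (hE : ∃ a, E a) (hQ : ∀ a, E a → AnsRel Q a p)
    (hP : ∀ q, P q ↔ q = p) : Sim E P Q := by
  refine ⟨fun a ha => ⟨p, (hP p).2 rfl, hQ a ha⟩, fun q hq => ?_⟩
  obtain rfl := (hP q).1 hq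
  obtain ⟨a, ha⟩ := hE
  exact ⟨a, ha, hQ a ha⟩

theorem bind {K : Val L → Env L → Heap L → Ans L → Prop} {K' : PVal L → PAns L → Prop}
    (h : Sim E P Q) (hK : ∀ v R H w, Q v R H w → Sim (K v R H) (K' w) Q') :
    Sim (Ans.Bind E K) (PAns.Bind P K') Q' := by
  constructor
  · rintro a (⟨ha, rfl⟩ | ⟨v, R, H, ha, hb⟩)
    · obtain ⟨p, hp, ⟨⟩⟩ := h.1 _ ha
      exact ⟨.fail, .inl ⟨hp, rfl⟩, .fail⟩
    · obtain ⟨p, hp, ⟨hQ⟩⟩ := h.1 _ ha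
      obtain ⟨q, hq, hQ'⟩ := (hK _ _ _ _ hQ).1 a hb
      exact ⟨q, .inr ⟨_, hp, hq⟩, hQ'⟩
  · rintro p (⟨hp, rfl⟩ | ⟨w, hp, hq⟩)
    · obtain ⟨a, ha, ⟨⟩⟩ := h.2 _ hp
      exact ⟨.fail, .inl ⟨ha, rfl⟩, .fail⟩
    · obtain ⟨a, ha, ⟨hQ⟩⟩ := h.2 _ hp
      obtain ⟨b, hb, hQ'⟩ := (hK _ _ _ _ hQ).2 p hq
      exact ⟨b, .inr ⟨_, _, _, ha, hb⟩, hQ'⟩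

theorem map {K' : PVal L → PAns L → Prop} (h : Sim E P Q) (g : Env L → Env L)
    (hK : ∀ v R H w, Q v R H w → ∃ w', Q' v (g R) H w' ∧ ∀ p, K' w p ↔ p = .ok w') :
    Sim (Ans.Bind E fun v R H a => a = .ok v (g R) H) (PAns.Bind P K') Q' := by
  refine h.bind fun v R H w hQ => ?_
  obtain ⟨w', hQ', hw'⟩ := hK v R H w hQ
  exact .of_unique ⟨_, rfl⟩ (by rintro _ rfl; exact .ok hQ') hw'

theorem map_env (h : Sim E P Q) (g : Env L → Env L)
    (hQ : ∀ v R H w, Q v R H w → Q' v (g R) H w) :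
    Sim (Ans.Bind E fun v R H a => a = .ok v (g R) H) P Q' :=
  (h.map g fun v R H w hw => ⟨w, hQ v R H w hw, fun _ => .rfl⟩).congr (fun _ => .rfl)
    fun _ => PAns.bind_ok.symm

end Sim

/-- The variables captured by the recursive functions of `Γ` are in `Γ'`. Without this a `let`
might rebind a variable captured by a recursive function, after that variable was consumed. -/
def Live (Γ Γ' : TEnv) : Prop :=
  ∀ f ∈ Γ, ∀ τ₁ Δ τ₂, f.ty = .rfun τ₁ Δ τ₂ → NTEnv.toTEnv Δ ⊆ Γ'

theorem FunsRel.congr {Γ Γ' : TEnv} {θ θ' : Reps L} (h : FunsRel Γ θ) (hΓ : Γ' ⊆ Γ)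
    (hl : Live Γ' Γ') (hθ : ∀ x ∈ Γ', (θ' x).SameUpToStore x.ty (θ x)) : FunsRel Γ' θ' := by
  intro f hf τ₁ Δ τ₂ hσ
  obtain ⟨hsrc, htgt⟩ := hθ f hf
  rw [hσ] at htgt
  have htgt : (θ' f).tgt = (θ f).tgt := htgt
  rw [hsrc, htgt]
  exact (h f (hΓ hf) τ₁ Δ τ₂ hσ).congr fun x hx => hθ x (hl f hf τ₁ Δ τ₂ hσ hx)

theorem FunRel.set_of_notMem {τ₁ τ₂ : NTy} {Δ : NTEnv} {θ : Reps L} {u : Val L} {c : PVal L}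
    (h : FunRel τ₁ Δ τ₂ θ u c) {H : Heap L} (hΔ : Stored H Δ.toTEnv θ) {x : Var}
    (hx : x ∉ Δ.toTEnv) (β : Rep L) : FunRel τ₁ Δ τ₂ (θ.set x β) u c :=
  h.congr fun y hy => by
    rw [θ.set_of_ne (ne_of_mem_of_not_mem hy hx)]
    exact ⟨rfl, (hΔ.valid y hy).sameCode⟩

/-- The state before the evaluation of a term in the type environment `Γ`, with heap `H` and source
environment `R`, and of its translation, with target environment `S`. -/
structure State (Γ : TEnv) (H : Heap L) (R : Env L) (S : PEnv L) (θ : Reps L) : Prop where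
  fin : H.IsFinite
  src : ∀ x ∈ Γ, R x = some (θ x).src
  tgt : ∀ x ∈ Γ, S (.src x) = some (θ x).tgt
  store : Stored H Γ θ
  funs : FunsRel Γ θ

theorem State.set_append {Γ : TEnv} {H : Heap L} {R : Env L} {S : PEnv L} {θ : Reps L}
    (h : State Γ H R S θ) (hl : Live Γ Γ) {x : Var} {β : Rep L} (hx : x ∉ Γ)
    (hR : R x = some β.src) (hS : S (.src x) = some β.tgt) (hβ : β.ValidAt H x.ty)
    (hdisj : ∀ y ∈ Γ, Disjoint β.own (θ y).own)
    (hfun : ∀ τ₁ Δ τ₂, x.ty = .rfun τ₁ Δ τ₂ →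
      NTEnv.toTEnv Δ ⊆ Γ ∧ FunRel τ₁ Δ τ₂ θ β.src β.tgt) :
    State (Γ ++ [x]) H R S (θ.set x β) := by
  have hold {y : Var} (hy : y ∈ Γ) : θ.set x β y = θ y :=
    θ.set_of_ne (ne_of_mem_of_not_mem hy hx) β
  have hset {τ₁ τ₂ Δ u c} (hΔ : NTEnv.toTEnv Δ ⊆ Γ) (hu : FunRel τ₁ Δ τ₂ θ u c) :=
    hu.set_of_notMem (h.store.subset hΔ) (fun hm => hx (hΔ hm)) β
  refine ⟨h.fin, List.forall_mem_append.2 ⟨fun y hy => hold hy ▸ h.src y hy, by simpa using hR⟩,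
    List.forall_mem_append.2 ⟨fun y hy => hold hy ▸ h.tgt y hy, by simpa using hS⟩,
    h.store.set_append hx hβ hdisj, List.forall_mem_append.2 ⟨fun f hf τ₁ Δ τ₂ hσ => ?_, ?_⟩⟩
  · rw [hold hf]
    exact hset (hl f hf τ₁ Δ τ₂ hσ) (h.funs f hf τ₁ Δ τ₂ hσ)
  · rintro _ hf τ₁ Δ τ₂ hσ
    obtain rfl := List.mem_singleton.1 hf
    rw [Reps.set_self]
    exact hset (hfun τ₁ Δ τ₂ hσ).1 (hfun τ₁ Δ τ₂ hσ).2

theorem Stored.returns_pack {call : PVal L → PVal L → PAns L → Prop} {Γ : TEnv} {H : Heap L}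
    {S : PEnv L} {θ : Reps L} (h : Stored H Γ θ) (hS : ∀ x ∈ Γ, S (.src x) = some (θ x).tgt) :
    (pack Γ).Returns call S (.tup (Γ.comps θ.tgt)) :=
  PTerm.returns_pack fun x hx => ⟨hS x hx, (h.valid x hx).sameCode⟩

/-- What holds after the evaluation of a term of type `τ` from the heap `H` and the representations
`θ` of `Γ`, with `Γ'` left of `Γ`: the result of the translation is the representation of the value
and of the store for `Γ'`. The latter may be followed by the components of variables whose scope has
ended, since a `let` does not repack the store. -/
def Post (Γ : TEnv) (τ : NTy) (Γ' : TEnv) (H : Heap L) (θ : Reps L) (u : Val L) (R' : Env L)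
    (H' : Heap L) (W : PVal L) : Prop :=
  ∃ (β : Rep L) (θ' : Reps L) (extra : List (PVal L)), u = β.src ∧
    W = .tuple ![β.tgt, .tup (Γ'.comps θ'.tgt ++ extra)] ∧ β.Valid H' τ ∧
    (∀ x ∈ Γ', R' x = some (θ' x).src) ∧ Evolves H (footprint Γ θ) θ H' β.own Γ' θ'

theorem Post.of_evolves {Γ Γ' : TEnv} {τ : NTy} {H H' : Heap L} {θ θ' : Reps L} {R' : Env L}
    {β : Rep L} (hβ : β.Valid H' τ) (hR : ∀ x ∈ Γ', R' x = some (θ' x).src)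
    (h : Evolves H (footprint Γ θ) θ H' β.own Γ' θ') :
    Post Γ τ Γ' H θ β.src R' H' (.tuple ![β.tgt, .tup (Γ'.comps θ'.tgt)]) :=
  ⟨β, θ', [], rfl, by rw [List.append_nil], hβ, hR, h⟩

/-- What holds after a call of a function of type `τ₁ →^Δ τ₂`, from the heap `H` and the
representations `θ` of the captured variables and `β₁` of the argument: the result of the call of
the target code represents the value, the argument, and the store for `Δ`. -/
def CallPost (τ₁ : NTy) (Δ : NTEnv) (τ₂ : NTy) (H : Heap L) (θ : Reps L) (β₁ : Rep L) (u : Val L)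
    (_ : Env L) (H' : Heap L) (W : PVal L) : Prop :=
  ∃ (β β₁' : Rep L) (θ' : Reps L), u = β.src ∧
    W = .tuple ![β.tgt, β₁'.tgt, .tup (Δ.toTEnv.comps θ'.tgt)] ∧ β.Valid H' τ₂ ∧
    β₁'.Valid H' τ₁ ∧ β₁'.SameUpToStore (.n τ₁) β₁ ∧ Disjoint β.own β₁'.own ∧
    Evolves H (β₁.own ∪ footprint Δ.toTEnv θ) θ H' (β.own ∪ β₁'.own) Δ.toTEnv θ'

/-- Calls of functions and of their translations simulate each other. -/
def CallSim (call : Val L → Val L → Heap L → Ans L → Prop)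
    (pcall : PVal L → PVal L → PAns L → Prop) : Prop :=
  ∀ {τ₁ Δ τ₂ u c H θ β₁}, H.IsFinite → FunRel τ₁ Δ τ₂ θ u c → Stored H Δ.toTEnv θ →
    β₁.Valid H τ₁ → (∀ x ∈ Δ.toTEnv, Disjoint β₁.own (θ x).own) →
    Sim (call u β₁.src H) (pcall c (.tuple ![β₁.tgt, .tup (Δ.toTEnv.comps θ.tgt)]))
      (CallPost τ₁ Δ τ₂ H θ β₁)

theorem Env.excTy_of_mem {R : Env L} {Γ : TEnv} {x y : Var} {σ : FTy} (hy : y ∈ Γ.excTy x σ) :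
    R.excTy x σ y = R y := by
  obtain ⟨-, hs | hne⟩ := TEnv.mem_excTy.1 hy
  · rw [Env.excTy, if_pos hs]
  · unfold Env.excTy
    split
    · rfl
    · exact Function.update_of_ne hne _ _

theorem Env.split_eq_of_mem {R : Env L} {Γ : TEnv} {s : Finset Var} {y : Var}
    (hy : y ∈ (Γ.split s).2) : (R.split s).2 y = R y :=
  if_pos (of_decide_eq_true (List.mem_filter.1 hy).2)

section Leaves

variable {Γ Γ' : TEnv} {τ τ₁ τ₂ : NTy} {ρ : RTy} {x : Var} {H H' : Heap L} {R R' : Env L}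
  {S : PEnv L} {θ : Reps L} {A : Set ℕ} {β : Rep L}
  {call : Val L → Val L → Heap L → Ans L → Prop} {pcall : PVal L → PVal L → PAns L → Prop}

theorem State.post (h : State Γ H R S θ) (hfin : H'.IsFinite) (hf : Frame H H' A β.own)
    (hA : A ⊆ footprint Γ θ) (hβ : β.Valid H' τ)
    (hΓ' : ∀ x ∈ Γ', x ∈ Γ ∧ Disjoint A (θ x).own) (hR : ∀ x ∈ Γ', R' x = R x) :
    Post Γ τ Γ' H θ β.src R' H' (.tuple ![β.tgt, .tup (Γ'.comps θ.tgt)]) :=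
  .of_evolves hβ (fun x hx => (hR x hx).trans (h.src x (hΓ' x hx).1))
    (.of_frame hfin hf h.store hA hΓ')

theorem State.post_excTy (h : State Γ H R S θ) (hx : x ∈ Γ) {σ : FTy} (hfin : H'.IsFinite)
    (hf : Frame H H' A β.own) (hA : A ⊆ (θ x).own) (hσ : σ.sharable → A = ∅)
    (hβ : β.Valid H' τ) :
    Post Γ τ (Γ.excTy x σ) H θ β.src (R.excTy x σ) H'
      (.tuple ![β.tgt, .tup ((Γ.excTy x σ).comps θ.tgt)]) :=
  h.post hfin hf (hA.trans (subset_footprint hx θ)) hβ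
    (fun y hy => ⟨(TEnv.mem_excTy.1 hy).1, h.store.disjoint_excTy hx hA hσ y hy⟩)
    fun _ => Env.excTy_of_mem

theorem State.post_const (h : State Γ H R S θ) (hβ : β.Valid H τ) (h₀ : β.own = ∅) :
    Post Γ τ Γ H θ β.src R H (.tuple ![β.tgt, .tup (Γ.comps θ.tgt)]) :=
  h.post h.fin (h₀ ▸ .refl H ∅) (Set.empty_subset _) hβ
    (fun _ hx => ⟨hx, Set.empty_disjoint _⟩) fun _ _ => rfl

theorem State.returns_pack (h : State Γ H R S θ) (hΓ : Γ' ⊆ Γ) :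
    (pack Γ').Returns pcall S (.tup (Γ'.comps θ.tgt)) :=
  (h.store.subset hΓ).returns_pack fun x hx => h.tgt x (hΓ hx)

theorem Sim.fail (N : PTerm L) {Q : Val L → Env L → Heap L → PVal L → Prop} :
    Sim (Term.fail.ev call R H) ((pair .fail N).ev pcall S) Q :=
  .of_unique ⟨_, rfl⟩ (by rintro _ rfl; exact .fail) fun _ => ev_pair_fail

theorem State.sim_unit (h : State Γ H R S θ) :
    Sim (Term.unit.ev call R H) ((pair .unit (pack Γ)).ev pcall S) (Post Γ .unit Γ H θ) :=
  .of_unique ⟨_, rfl⟩ (by rintro _ rfl; exact .ok (h.post_const .unit rfl))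
    (returns_pair (fun _ => .rfl) (h.returns_pack (List.Subset.refl Γ)))

theorem State.sim_const (h : State Γ H R S θ) (c : L.base.Carrier) :
    Sim ((Term.const c).ev call R H) ((pair (.const c) (pack Γ)).ev pcall S) (Post Γ .b Γ H θ) :=
  .of_unique ⟨_, rfl⟩ (by rintro _ rfl; exact .ok (h.post_const (.const c) rfl))
    (returns_pair (fun _ => .rfl) (h.returns_pack (List.Subset.refl Γ)))

theorem State.sim_var (h : State Γ H R S θ) (hx : Γ.Has x (.n τ)) :
    Sim ((Term.var x).ev call R H) ((pair (v x) (pack (Γ.exc x))).ev pcall S)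
      (Post Γ τ (Γ.exc x) H θ) := by
  refine .of_unique ⟨_, _, h.src x hx.1, rfl⟩ ?_
    (returns_pair (returns_var (h.tgt x hx.1)) (h.returns_pack (TEnv.excTy_sublist ..).subset))
  rintro _ ⟨u, hu, rfl⟩
  obtain rfl := Option.some.inj ((h.src x hx.1).symm.trans hu)
  exact .ok (h.post_excTy hx.1 h.fin (.refl ..) subset_rfl (h.store.valid x hx.1).own_eq_empty
    (h.store.validAt hx))

theorem State.sim_op (h : State Γ H R S θ) {k : ℕ} {o : L.Op k} {xs : Fin k → Var}
    (hxs : ∀ i, Γ.Has (xs i) (.n .b)) :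
    Sim ((Term.op o xs).ev call R H) ((pair (.op o fun i => .src (xs i)) (pack Γ)).ev pcall S)
      (Post Γ .b Γ H θ) := by
  choose cs hsrc htgt using fun i => Rep.Valid.exists_const (h.store.validAt (hxs i))
  have hR (i) : R (xs i) = some (.atom (.const (cs i))) := hsrc i ▸ h.src _ (hxs i).1
  have hS (i) : S (.src (xs i)) = some (.const (cs i)) := htgt i ▸ h.tgt _ (hxs i).1
  refine .of_unique ⟨_, cs, hR, rfl⟩ ?_
    (returns_pair (w₁ := .const (L.sem o cs)) (fun a => ?_)
      (h.returns_pack (List.Subset.refl Γ)))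
  · rintro _ ⟨cs', hcs, rfl⟩
    obtain rfl : cs = cs' := funext fun i => by simpa [hR] using hcs i
    exact .ok (h.post_const (.const _) rfl)
  · constructor
    · rintro ⟨cs', hcs, rfl⟩
      obtain rfl : cs = cs' := funext fun i => by simpa [hS] using hcs i
      rfl
    · rintro rfl
      exact ⟨cs, hS, rfl⟩

theorem State.sim_deref (h : State Γ H R S θ) (hx : Γ.Has x (.n (.r (.ref ρ)))) :
    Sim ((Term.deref x).ev call R H)
      ((pair (v x) (pack (Γ.excTy x (.n (.r ρ))))).ev pcall S)
      (Post Γ (.r ρ) (Γ.excTy x (.n (.r ρ))) H θ) := by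
  obtain ⟨ℓ, b, F, hθ, hℓ, hb, -⟩ := Rep.Valid.exists_of_ref (h.store.validAt hx)
  have hR : R x = some (.atom (.loc ℓ)) := by rw [h.src x hx.1, hθ]
  have hF : F ⊆ (θ x).own := by
    rw [hθ]
    exact Set.subset_insert ℓ F
  refine .of_unique ⟨_, ρ, ℓ, b, hx.2, hR, hℓ, rfl⟩ ?_
    (returns_pair (returns_var (h.tgt x hx.1)) (h.returns_pack (TEnv.excTy_sublist ..).subset))
  rintro _ ⟨ρ', ℓ', b', hρ, hu, hb', rfl⟩
  obtain rfl : ρ = ρ' := by simpa using hx.2.symm.trans hρ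
  obtain rfl : ℓ = ℓ' := by simpa [hR] using hu
  obtain rfl : b = b' := by simpa [hℓ] using hb'
  exact .ok (h.post_excTy hx.1 h.fin (.refl ..) hF
    (fun hs => hb.own_eq_empty (NTy.size_eq_zero_of_sharable hs)) hb)

theorem State.sim_mkref (h : State Γ H R S θ) (hx : Γ.Has x (.n (.r ρ))) :
    Sim ((Term.mkref x).ev call R H) ((pair (v x) (pack (Γ.exc x))).ev pcall S)
      (Post Γ (.r (.ref ρ)) (Γ.exc x) H θ) := by
  have hθ : (θ x).Valid H (.r ρ) := h.store.validAt hx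
  obtain ⟨b, hb⟩ := hθ.exists_atom
  have hR : R x = some (.atom b) := hb ▸ h.src x hx.1
  obtain ⟨ℓ₀, hℓ₀⟩ := h.fin.exists_fresh
  refine .of_unique ⟨_, ℓ₀, b, hR, hℓ₀, rfl⟩ ?_
    (returns_pair (returns_var (h.tgt x hx.1)) (h.returns_pack (TEnv.excTy_sublist ..).subset))
  rintro _ ⟨ℓ, b', hb', hℓ, rfl⟩
  obtain rfl : b = b' := by simpa [hR] using hb'
  exact .ok (h.post_excTy hx.1 (h.fin.set ℓ b) (.heap_set (.inr hℓ) subset_rfl b) subset_rfl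
    (h.store.valid x hx.1).own_eq_empty (hθ.ref_set hb fun hm => hθ.ne_none ℓ hm hℓ))

/-- The new content of `y` takes over what `x` owns. -/
theorem State.evolves_assign (h : State Γ H R S θ) {y : Var} (hy : Γ.Has y (.n (.r (.ref ρ))))
    (hx : Γ.Has x (.n (.r ρ))) {ℓ : ℕ} {b : Atom L} (hℓ : (θ y).src = .atom (.loc ℓ))
    (hb : (θ x).src = .atom b) :
    Evolves H (footprint Γ θ) θ (H.set ℓ b) ∅ (Γ.exc x)
      (θ.set y ⟨.atom (.loc ℓ), (θ x).tgt, insert ℓ (θ x).own⟩) := by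
  have hyx : y ≠ x := by
    rintro rfl
    have := congrArg sizeOf (hy.2.symm.trans hx.2)
    simp at this
  obtain ⟨ℓ', a, F, hθ, -⟩ := Rep.Valid.exists_of_ref (h.store.validAt hy)
  obtain rfl : ℓ' = ℓ := by simpa [hℓ] using congrArg Rep.src hθ.symm
  have hmem : ℓ' ∈ (θ y).own := by
    rw [hθ]
    exact Set.mem_insert ..
  set A := (θ y).own ∪ (θ x).own
  have hframe : Frame H (H.set ℓ' b) A (∅ ∪ insert ℓ' (θ x).own) := by
    rw [Set.empty_union]
    exact .heap_set (.inl (.inl hmem)) (Set.insert_subset_insert Set.subset_union_right) b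
  have hset := Evolves.set_append (G := ∅) (θ := θ) (x := y) (θ' := θ)
    (β := ⟨.atom (.loc ℓ'), (θ x).tgt, insert ℓ' (θ x).own⟩) (.nil (h.fin.set ℓ' b) hframe)
    List.not_mem_nil
    (hy.2 ▸ Rep.Valid.ref_set (h.store.validAt hx) hb
      (Set.disjoint_left.1 (h.store.sep y hy.1 x hx.1 hyx) hmem)) (Set.empty_disjoint _)
    ⟨hℓ.symm, by rw [hy.2]; trivial⟩
  refine hset.frame_rule h.store
    (Set.union_subset (subset_footprint hy.1 θ) (subset_footprint hx.1 θ)) fun z hz hzy => ?_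
  have hzy : z ≠ y := by simpa using hzy
  have hzΓ := (TEnv.mem_excTy.1 hz).1
  exact ⟨hzΓ, θ.set_of_ne hzy _, Set.disjoint_union_left.2 ⟨h.store.sep y hy.1 z hzΓ hzy.symm,
    h.store.disjoint_excTy hx.1 subset_rfl (h.store.valid x hx.1).own_eq_empty z hz⟩⟩

theorem State.sim_assign (h : State Γ H R S θ) {y : Var} (hy : Γ.Has y (.n (.r (.ref ρ))))
    (hx : Γ.Has x (.n (.r ρ))) :
    Sim ((Term.assign y x).ev call R H)
      ((PTerm.letE (.src y) (v x) (pair .unit (pack (Γ.exc x)))).ev pcall S)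
      (Post Γ .unit (Γ.exc x) H θ) := by
  obtain ⟨b, hb⟩ := Rep.Valid.exists_atom (h.store.validAt hx)
  obtain ⟨ℓ, a, F, hθ, -⟩ := Rep.Valid.exists_of_ref (h.store.validAt hy)
  have hℓ : (θ y).src = .atom (.loc ℓ) := by rw [hθ]
  have hRx : R x = some (.atom b) := hb ▸ h.src x hx.1
  have hRy : R y = some (.atom (.loc ℓ)) := hℓ ▸ h.src y hy.1
  have hev := h.evolves_assign hy hx hℓ hb
  have hΓ {z : Var} (hz : z ∈ Γ.exc x) : z ∈ Γ := (TEnv.mem_excTy.1 hz).1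
  refine .of_unique ⟨_, ℓ, b, hRy, hRx, rfl⟩ ?_ fun a =>
    (ev_letE_of_returns (returns_var (h.tgt x hx.1))).trans
      (returns_pair (w₁ := .unit) (fun _ => .rfl)
        (hev.store.returns_pack fun z hz => ?_) a)
  · rintro _ ⟨ℓ', b', hℓ', hb', rfl⟩
    obtain rfl : ℓ = ℓ' := by simpa [hRy] using hℓ'
    obtain rfl : b = b' := by simpa [hRx] using hb'
    exact .ok (.of_evolves .unit (fun z hz => (Env.excTy_of_mem hz).trans
      ((h.src z (hΓ hz)).trans (congrArg some (hev.same z hz).1.symm))) hev)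
  · by_cases hzy : z = y
    · subst hzy
      simp
    · simpa [hzy] using h.tgt z (hΓ hz)

theorem State.sim_fun (h : State Γ H R S θ) {s : Finset Var} {Δ : NTEnv}
    (hs : (Δ.toTEnv, Γ') = Γ.split s) {u : Val L} {c : PVal L} {P : PTerm L} {M : Term L}
    (hu : Captures Δ (R.split s).1 S θ → FunRel τ₁ Δ τ₂ θ u c) (hP : P.Returns pcall S c)
    (hM : ∀ a, M.ev call R H a ↔ a = .ok u (R.split s).2 H) :
    Sim (M.ev call R H) ((pair (closure P (pack Δ.toTEnv)) (pack Γ')).ev pcall S)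
      (Post Γ (.fn τ₁ Δ.size τ₂) Γ' H θ) := by
  obtain ⟨hΔ, rfl⟩ := Prod.mk.inj hs
  have hmem {x : Var} : x ∈ Δ.toTEnv ↔ x ∈ Γ ∧ x ∈ s := by
    rw [hΔ]
    simp
  have hΔΓ : Δ.toTEnv ⊆ Γ := fun x hx => (hmem.1 hx).1
  have hΓ : (Γ.split s).2 ⊆ Γ := List.filter_subset_self _
  have hu := hu fun x hx => ⟨(if_pos (hmem.1 hx).2).trans (h.src x (hΔΓ hx)), _, h.tgt x (hΔΓ hx),
    (h.store.valid x (hΔΓ hx)).sameCode⟩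
  refine .of_unique ⟨_, (hM _).2 rfl⟩ (fun a ha => ?_)
    (returns_pair (returns_closure hP (h.returns_pack hΔΓ)) (h.returns_pack hΓ))
  obtain rfl := (hM a).1 ha
  refine .ok (h.post h.fin (.refl ..) (footprint_mono hΔΓ θ)
    ((h.store.subset hΔΓ).valid_fn hu) (fun x hx => ⟨hΓ hx, ?_⟩) fun _ => Env.split_eq_of_mem)
  have hx' := of_decide_eq_true (List.mem_filter.1 hx).2
  rcases hx' with hxs | hsh
  · exact h.store.disjoint_footprint (hΓ hx) hΔΓ fun hm => hxs (hmem.1 hm).2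
  · rw [(h.store.valid x (hΓ hx)).own_eq_empty hsh]
    exact Set.disjoint_empty _

end Leaves

section Compound

variable {Γ Γ' Γ'' : TEnv} {τ τ' τ₁ τ₂ : NTy} {x : Var} {H H₁ H₂ : Heap L} {R : Env L}
  {S : PEnv L} {θ θ' : Reps L} {β : Rep L}
  {call : Val L → Val L → Heap L → Ans L → Prop} {pcall : PVal L → PVal L → PAns L → Prop}

theorem State.of_let (h : State Γ H R S θ) (hΓ : Γ'' ⊆ Γ) (hl : Live Γ'' Γ'')
    (hx : x.ty = .n τ') (hxΓ : x ∉ Γ'') {R₁ : Env L} {S₁ : PEnv L}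
    (hβ : β.Valid H₁ τ') (hR : ∀ y ∈ Γ'', R₁ y = some (θ' y).src)
    (hS : S₁ (.src x) = some β.tgt) (hev : Evolves H (footprint Γ θ) θ H₁ β.own Γ'' θ') :
    State (Γ'' ++ [x]) H₁ (R₁.set x β.src) (S₁.rebind Γ'' θ'.tgt) (θ'.set x β) := by
  have hne {y : Var} (hy : y ∈ Γ'') : y ≠ x := ne_of_mem_of_not_mem hy hxΓ
  have hΓ'' : State Γ'' H₁ (R₁.set x β.src) (S₁.rebind Γ'' θ'.tgt) θ' :=
    ⟨hev.fin, fun y hy => (Function.update_of_ne (hne hy) _ _).trans (hR y hy),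
      fun y hy => PEnv.rebind_of_mem hy, hev.store, h.funs.congr hΓ hl hev.same⟩
  exact hΓ''.set_append hl hxΓ (Function.update_self ..) ((PEnv.rebind_of_notMem hxΓ).trans hS)
    (hx ▸ hβ) hev.disj fun _ _ _ hσ => by cases hx.symm.trans hσ

theorem Post.of_let (hev : Evolves H (footprint Γ θ) θ H₁ β.own Γ'' θ') (hx : x ∉ Γ'')
    (hΓ' : Γ'.Sublist (Γ'' ++ [x])) {u : Val L} {W : PVal L}
    (h : Post (Γ'' ++ [x]) τ Γ' H₁ (θ'.set x β) u R H₂ W) :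
    Post Γ τ (Γ'.erase x) H θ u (R.erase x) H₂ W := by
  obtain ⟨hsub, Γ₁, hΓ₁⟩ := TEnv.eq_erase_append hx hΓ'
  obtain ⟨β₂, θ₂, extra, rfl, rfl, hβ₂, hR, hev₂⟩ := h
  rw [footprint_append_set hx, Set.union_comm] at hev₂
  refine ⟨β₂, θ₂, TEnv.comps Γ₁ θ₂.tgt ++ extra, rfl, ?_, hβ₂, fun y hy => ?_,
    hev.trans (hev₂.subset fun y hy => (TEnv.mem_erase.1 hy).1) fun y hy =>
      ⟨hsub.subset hy, θ'.set_of_ne (TEnv.mem_erase.1 hy).2 β⟩⟩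
  · conv_lhs => rw [hΓ₁]
    simp only [TEnv.comps, List.flatMap_append, List.append_assoc]
  · obtain ⟨hyΓ', hyx⟩ := TEnv.mem_erase.1 hy
    exact (Function.update_of_ne hyx _ _).trans (hR y hyΓ')

theorem State.sim_let (h : State Γ H R S θ) {M₁ M₂ : Term L} {N₁ N₂ : PTerm L}
    (hx : x.ty = .n τ') (hΓ : Γ'' ⊆ Γ) (hl : Live Γ'' Γ'') (hnd : (Γ'' ++ [x]).Nodup)
    (hΓ' : Γ'.Sublist (Γ'' ++ [x]))
    (ih₁ : Sim (M₁.ev call R H) (N₁.ev pcall S) (Post Γ τ' Γ'' H θ))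
    (ih₂ : ∀ {H R S θ}, State (Γ'' ++ [x]) H R S θ →
      Sim (M₂.ev call R H) (N₂.ev pcall S) (Post (Γ'' ++ [x]) τ Γ' H θ)) :
    Sim ((Term.letE x M₁ M₂).ev call R H)
      ((letPair (.src x) .h N₁ (unpack Γ'' N₂)).ev pcall S)
      (Post Γ τ (Γ'.erase x) H θ) := by
  obtain ⟨hndΓ'', -, hdisj⟩ := List.nodup_append.1 hnd
  have hxΓ : x ∉ Γ'' := fun hm => hdisj x hm x (List.mem_singleton_self x) rfl
  refine ih₁.bind fun u R₁ H₁ W hQ => ?_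
  obtain ⟨β, θ', extra, rfl, rfl, hβ, hR, hev⟩ := hQ
  set us := Γ''.comps θ'.tgt ++ extra
  have hst := h.of_let hΓ hl hx hxΓ hβ hR (hev := hev)
    (S₁ := ((S.set .p (.tuple ![β.tgt, .tup us])).set (.src x) β.tgt).set .h (.tup us)) (by simp)
  refine ((ih₂ hst).map_env (·.erase x) fun _ _ _ _ => .of_let hev hxΓ hΓ').congr
    (fun _ => .rfl) fun a => ?_
  refine (ev_split₂ (PEnv.set_self ..) (by simp)).trans
    (ev_unpack hndΓ'' (PEnv.set_self ..) fun y hy => ⟨(θ y).tgt, ?_, (hev.same y hy).2⟩)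
  have hyx : y ≠ x := ne_of_mem_of_not_mem hy hxΓ
  simp [hyx, h.tgt y (hΓ hy)]

theorem State.sim_ite (h : State Γ H R S θ) {M₁ M₂ : Term L} {N₁ N₂ : PTerm L}
    (hx : Γ.Has x (.n .b))
    (ih₁ : Sim (M₁.ev call R H) (N₁.ev pcall S) (Post Γ τ Γ' H θ))
    (ih₂ : Sim (M₂.ev call R H) (N₂.ev pcall S) (Post Γ τ Γ' H θ)) :
    Sim ((Term.ite x M₁ M₂).ev call R H) ((PTerm.ite (.src x) N₁ N₂).ev pcall S)
      (Post Γ τ Γ' H θ) := by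
  obtain ⟨c, hsrc, htgt⟩ := Rep.Valid.exists_const (h.store.validAt hx)
  have hR : R x = some (.atom (.const c)) := hsrc ▸ h.src x hx.1
  have hS : S (.src x) = some (.const c) := htgt ▸ h.tgt x hx.1
  by_cases hc : L.base.Truthy c
  · exact ih₁.congr (fun a => by simp [Term.ev, hR, hc]) fun p => by simp [PTerm.ev, hS, hc]
  · exact ih₂.congr (fun a => by simp [Term.ev, hR, hc]) fun p => by simp [PTerm.ev, hS, hc]

theorem Term.ev_app {f : Var} {u v : Val L} (hf : R f = some u) (hx : R x = some v) {a : Ans L} :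
    (Term.app f x).ev call R H a ↔
      Ans.Bind (call u v H) (fun w _ H' a => a = .ok w R H') a := by
  simp [Term.ev, hf, hx]

theorem State.evolves_app (h : State Γ H R S θ) {f : Var} {Δ : NTEnv} {θ₀ : Reps L} {c : PVal L}
    {G : Set ℕ} {β₁ : Rep L} (hf : Γ.Has f (.n (.fn τ₁ Δ.size τ₂))) (hx : Γ.Has x (.n τ₁))
    (hfx : f ≠ x)
    (hθ : θ f = ⟨(θ f).src, .closure (Δ.toTEnv.comps θ₀.tgt) c, footprint Δ.toTEnv θ₀⟩)
    (hc : FunRel τ₁ Δ τ₂ θ₀ (θ f).src c) (hβ₁ : β₁.Valid H₁ τ₁)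
    (hs : β₁.SameUpToStore (.n τ₁) (θ x)) (hG : Disjoint G β₁.own)
    (hev : Evolves H ((θ x).own ∪ footprint Δ.toTEnv θ₀) θ₀ H₁ (G ∪ β₁.own) Δ.toTEnv θ') :
    Evolves H (footprint Γ θ) θ H₁ G Γ
      ((θ.set f ⟨(θ f).src, .closure (Δ.toTEnv.comps θ'.tgt) c, footprint Δ.toTEnv θ'⟩).set x
        β₁) := by
  have hvalid := hev.store.valid_fn (hc.congr hev.same)
  have hvalid₀ := Rep.Valid.length_comps (h.store.validAt hf)
  have hlen := hvalid.length_comps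
  have hown : (θ f).own = footprint Δ.toTEnv θ₀ := congrArg Rep.own hθ
  have hA : (θ x).own ∪ footprint Δ.toTEnv θ₀ = (θ x).own ∪ (θ f).own := by rw [hown]
  rw [hA] at hev
  rw [hθ] at hvalid₀
  simp only [FTy.comps, PVal.store_closure, NTy.size] at hvalid₀ hlen
  have hcell := ((Evolves.nil hev.fin hev.frame (θ := θ) (θ' := θ)).set_append (x := f)
    (β := ⟨(θ f).src, .closure (Δ.toTEnv.comps θ'.tgt) c, footprint Δ.toTEnv θ'⟩)
    List.not_mem_nil (hf.2 ▸ hvalid) (disjoint_footprint.2 hev.disj)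
    ⟨rfl, by rw [hf.2, hθ]; exact ⟨_, _, c, rfl, rfl, hlen, hvalid₀⟩⟩).set_append (x := x) (β := β₁)
    (by simpa using hfx.symm) (hx.2 ▸ hβ₁) hG (hx.2 ▸ hs)
  refine hcell.frame_rule h.store
    (Set.union_subset (subset_footprint hx.1 θ) (subset_footprint hf.1 θ)) fun y hy hyT => ?_
  obtain ⟨hyf, hyx⟩ : y ≠ f ∧ y ≠ x := by simpa using hyT
  exact ⟨hy, by simp [hyf, hyx], Set.disjoint_union_left.2
    ⟨h.store.sep x hx.1 y hy hyx.symm, h.store.sep f hf.1 y hy hyf.symm⟩⟩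

theorem State.sim_app (h : State Γ H R S θ) (hcall : CallSim call pcall) {f : Var} {m : ℕ}
    (hf : Γ.Has f (.n (.fn τ₁ m τ₂))) (hx : Γ.Has x (.n τ₁)) :
    Sim ((Term.app f x).ev call R H)
      ((letTriple .r (.src x) .h
          (.letE .code (codeOf f) (.app .code (pair (v x) (envOf f))))
          (.letE (.src f) (closure (codeOf f) (.var .h)) (pair (.var .r) (pack Γ)))).ev pcall S)
      (Post Γ τ₂ Γ H θ) := by
  have hfx : f ≠ x := by
    rintro rfl
    have := congrArg sizeOf (hf.2.symm.trans hx.2)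
    simp at this
    omega
  obtain ⟨Δ, θ₀, c, rfl, hθ, hc, hst⟩ := Rep.Valid.exists_of_fn (h.store.validAt hf)
  have hS : S (.src f) = some (.closure (Δ.toTEnv.comps θ₀.tgt) c) := by rw [h.tgt f hf.1, hθ]
  have hdisj : Disjoint (θ x).own (footprint Δ.toTEnv θ₀) :=
    (h.store.sep x hx.1 f hf.1 hfx.symm).mono_right (congrArg Rep.own hθ).ge
  have hpcall (p : PAns L) :
      (PTerm.letE .code (codeOf f) (.app .code (pair (v x) (envOf f)))).ev pcall S p ↔
        pcall c (.tuple ![(θ x).tgt, .tup (Δ.toTEnv.comps θ₀.tgt)]) p :=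
    (ev_letE_of_returns (returns_codeOf hS)).trans (ev_app_of_returns (PEnv.set_self ..)
      (returns_pair (returns_var (h.tgt x hx.1)) (returns_envOf hS)))
  have hsim := (hcall h.fin hc hst (h.store.validAt hx) (disjoint_footprint.1 hdisj)).congr
    (fun _ => .rfl) hpcall
  refine (hsim.map (fun _ => R) ?_).congr (fun _ => Term.ev_app (h.src f hf.1) (h.src x hx.1))
    fun _ => .rfl
  rintro _ _ H₁ _ ⟨β, β₁, θ', rfl, rfl, hβ, hβ₁, hs, hG, hev⟩
  have hev := h.evolves_app hf hx hfx hθ hc hβ₁ hs hG hev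
  refine ⟨_, .of_evolves hβ (fun y hy =>
    (h.src y hy).trans (congrArg some (hev.same y hy).1.symm)) hev, fun a => ?_⟩
  refine (ev_split₃ (PEnv.set_self ..) (by simp) (by simp)).trans ((ev_letE_of_returns
    (returns_closure (returns_codeOf (by simpa [hfx] using hS))
      (returns_var (PEnv.set_self ..)))).trans
    (returns_pair (returns_var (by simp)) (hev.store.returns_pack fun y hy => ?_) a))
  obtain rfl | hyx := eq_or_ne y x
  · simp [hfx.symm]
  · obtain rfl | hyf := eq_or_ne y f
    · simp [hyx]
    · simp [hyx, hyf, h.tgt y hy]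

theorem State.evolves_rapp (h : State Γ H R S θ) {Δ : NTEnv} {G : Set ℕ} {β₁ : Rep L}
    (hx : Γ.Has x (.n τ₁)) (hΔ : Δ.toTEnv ⊆ Γ) (hxΔ : x ∉ Δ.toTEnv) (hβ₁ : β₁.Valid H₁ τ₁)
    (hs : β₁.SameUpToStore (.n τ₁) (θ x)) (hG : Disjoint G β₁.own)
    (hev : Evolves H ((θ x).own ∪ footprint Δ.toTEnv θ) θ H₁ (G ∪ β₁.own) Δ.toTEnv θ') :
    Evolves H (footprint Γ θ) θ H₁ G Γ
      (Reps.set (fun y => if y ∈ Δ.toTEnv then θ' y else θ y) x β₁) := by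
  have hT := (hev.congr (θ' := fun y => if y ∈ Δ.toTEnv then θ' y else θ y)
    fun y hy => if_pos hy).set_append hxΔ (hx.2 ▸ hβ₁) hG (hx.2 ▸ hs)
  refine hT.frame_rule h.store
    (Set.union_subset (subset_footprint hx.1 θ) (footprint_mono hΔ θ)) fun y hy hyT => ?_
  obtain ⟨hyΔ, hyx⟩ : y ∉ Δ.toTEnv ∧ y ≠ x := by simpa using hyT
  exact ⟨hy, by simp [hyx, hyΔ], Set.disjoint_union_left.2
    ⟨h.store.sep x hx.1 y hy hyx.symm, h.store.disjoint_footprint hy hΔ hyΔ⟩⟩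

theorem State.sim_rapp (h : State Γ H R S θ) (hcall : CallSim call pcall) {f : Var} {Δ : NTEnv}
    (hf : Γ.Has f (.rfun τ₁ Δ τ₂)) (hx : Γ.Has x (.n τ₁)) (hΔ : Δ.toTEnv ⊆ Γ)
    (hnd : Δ.toTEnv.Nodup) (hxΔ : x ∉ Δ.toTEnv) :
    Sim ((Term.app f x).ev call R H)
      ((PTerm.letE .h (pack Δ.toTEnv)
          (letTriple .r (.src x) .h (.app (.src f) (pair (v x) (.var .h)))
            (unpack Δ.toTEnv (pair (.var .r) (pack Γ))))).ev pcall S)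
      (Post Γ τ₂ Γ H θ) := by
  set S₀ := S.set .h (.tup (Δ.toTEnv.comps θ.tgt))
  have hpcall (p : PAns L) : (PTerm.app (.src f) (pair (v x) (.var .h))).ev pcall S₀ p ↔
      pcall (θ f).tgt (.tuple ![(θ x).tgt, .tup (Δ.toTEnv.comps θ.tgt)]) p :=
    ev_app_of_returns (h.tgt f hf.1)
      (returns_pair (returns_var (h.tgt x hx.1)) (returns_var (PEnv.set_self ..)))
  have hsim := (hcall h.fin (h.funs f hf.1 _ _ _ hf.2) (h.store.subset hΔ) (h.store.validAt hx)
    (fun y hy => h.store.sep x hx.1 y (hΔ hy) (ne_of_mem_of_not_mem hy hxΔ).symm)).congr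
    (fun _ => .rfl) hpcall
  refine (hsim.map (fun _ => R) ?_).congr (fun _ => Term.ev_app (h.src f hf.1) (h.src x hx.1))
    fun _ => ev_letE_of_returns (h.returns_pack hΔ)
  rintro _ _ H₁ _ ⟨β, β₁, θ', rfl, rfl, hβ, hβ₁, hs, hG, hev⟩
  have hcode := hev.same
  have hev := h.evolves_rapp hx hΔ hxΔ hβ₁ hs hG hev
  refine ⟨_, .of_evolves hβ (fun y hy =>
    (h.src y hy).trans (congrArg some (hev.same y hy).1.symm)) hev, fun a => ?_⟩
  refine (ev_split₃ (PEnv.set_self ..) (by simp) (by simp)).trans ((ev_unpack (w := θ'.tgt)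
    (post := []) hnd (by simp) fun y hy => ⟨(θ y).tgt, ?_, (hcode y hy).2⟩).trans
    (returns_pair (w₁ := β.tgt) (returns_var (by simp [PEnv.rebind]))
      (hev.store.returns_pack fun y hy => ?_) a))
  · simp [ne_of_mem_of_not_mem hy hxΔ, h.tgt y (hΔ hy)]
  · by_cases hyΔ : y ∈ Δ.toTEnv
    · simp [PEnv.rebind_of_mem, hyΔ, ne_of_mem_of_not_mem hyΔ hxΔ, Reps.tgt]
    · rw [PEnv.rebind_of_notMem hyΔ]
      obtain rfl | hyx := eq_or_ne y x
      · simp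
      · simp [hyx, hyΔ, h.tgt y hy]

end Compound

theorem Tr.sim {call : Val L → Val L → Heap L → Ans L → Prop}
    {pcall : PVal L → PVal L → PAns L → Prop} (hcall : CallSim call pcall) {Γ Γ' : TEnv}
    {M : Term L} {τ : NTy} {N : PTerm L} (h : Tr Γ M τ Γ' N) (hl : Live Γ Γ') {H : Heap L}
    {R : Env L} {S : PEnv L} {θ : Reps L} (hp : State Γ H R S θ) :
    Sim (M.ev call R H) (N.ev pcall S) (Post Γ τ Γ' H θ) := by
  induction h generalizing H R S θ with
  | fail => exact .fail _
  | unit => exact hp.sim_unit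
  | @const Γ c => exact hp.sim_const c
  | var _ hx => exact hp.sim_var hx
  | op _ hxs => exact hp.sim_op hxs
  | deref _ hx => exact hp.sim_deref hx
  | mkref _ hx => exact hp.sim_mkref hx
  | assign _ hy hx => exact hp.sim_assign hy hx
  | @letE Γ Γ' Γ'' x τ τ' M₁ M₂ N₁ N₂ hx h₁ h₂ ih₁ ih₂ =>
    have hsub := (TEnv.eq_erase_append h₂.wf.notMem h₂.sublist).1.subset
    have hl₁ : Live Γ Γ'' := fun f hf τ₁ Δ τ₂ hσ y hy =>
      hsub (hl f hf τ₁ Δ τ₂ hσ hy)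
    have hΓ := h₁.sublist.subset
    have hl₂ : Live (Γ'' ++ [x]) Γ' := by
      refine List.forall_mem_append.2 ⟨fun f hf τ₁ Δ τ₂ hσ y hy =>
        (TEnv.mem_erase.1 (hl f (hΓ hf) τ₁ Δ τ₂ hσ hy)).1, ?_⟩
      rintro _ hf _ _ _ hσ
      cases (List.mem_singleton.1 hf ▸ hσ).symm.trans hx
    exact hp.sim_let hx hΓ (fun f hf => hl₁ f (hΓ hf)) h₂.wf.1 h₂.sublist (ih₁ hl₁ hp) (ih₂ hl₂)
  | ite hx _ _ ih₁ ih₂ => exact hp.sim_ite hx (ih₁ hl hp) (ih₂ hl hp)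
  | lam _ hx h hs => exact hp.sim_fun hs (.lam hx h) (fun _ => .rfl) fun _ => .rfl
  | fix _ hf hx h hs => exact hp.sim_fun hs (.fix hf hx h) (fun _ => .rfl) fun _ => .rfl
  | app _ hf hx => exact hp.sim_app hcall hf hx
  | rapp wf hf hx hΔ =>
    have hΓ := (hΔ.trans List.filter_sublist).trans List.filter_sublist
    exact hp.sim_rapp hcall hf hx hΓ.subset (wf.1.sublist hΓ) fun hm =>
      (TEnv.mem_erase.1 (hΔ.subset hm)).2 rfl

/-! ### Simulation of calls -/

section Calls

variable {Θ : TEnv} {Δ : NTEnv} {τ₁ τ₂ : NTy} {x : Var} {H H' : Heap L} {R : Env L} {S : PEnv L}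
  {θ θ' θ₀ : Reps L} {β : Rep L}

theorem CallPost.of_evolves (hβ : β.Valid H' τ₂) (hx : Θ.Has x (.n τ₁)) (hΔ : Δ.toTEnv ⊆ Θ)
    (hxΔ : x ∉ Δ.toTEnv) (hθ : ∀ y ∈ Δ.toTEnv, θ y = θ₀ y)
    (hΘ : footprint Θ θ = footprint Δ.toTEnv θ₀ ∪ (θ x).own)
    (h : Evolves H (footprint Θ θ) θ H' β.own Θ θ') :
    CallPost τ₁ Δ τ₂ H θ₀ (θ x) β.src R H'
      (.tuple ![β.tgt, (θ' x).tgt, .tup (Δ.toTEnv.comps θ'.tgt)]) := by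
  refine ⟨β, θ' x, θ', rfl, rfl, hβ, h.store.validAt hx, hx.2 ▸ h.same x hx.1, h.disj x hx.1,
    h.fin, h.store.subset hΔ, fun y hy => hθ y hy ▸ h.same y (hΔ hy), fun y hy =>
      Set.disjoint_union_left.2 ⟨h.disj y (hΔ hy), h.store.sep x hx.1 y (hΔ hy)
        (ne_of_mem_of_not_mem hy hxΔ).symm⟩, h.frame.mono ?_ ?_⟩
  · rw [hΘ, Set.union_comm]
  · rw [Set.union_assoc]
    exact Set.union_subset_union_right _
      (Set.union_subset (subset_footprint hx.1 θ') (footprint_mono hΔ θ'))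

theorem sim_funBody {call : Val L → Val L → Heap L → Ans L → Prop}
    {pcall : PVal L → PVal L → PAns L → Prop} (hcall : CallSim call pcall) {M : Term L}
    {N : PTerm L} (hN : Tr Θ M τ₂ Θ N) (hΔ : Δ.toTEnv.Sublist Θ) (hx : Θ.Has x (.n τ₁))
    (hxΔ : x ∉ Δ.toTEnv) (hθ : ∀ y ∈ Δ.toTEnv, θ y = θ₀ y)
    (hΘ : footprint Θ θ = footprint Δ.toTEnv θ₀ ∪ (θ x).own)
    (hp : S .p = some (.tuple ![(θ x).tgt, .tup (Δ.toTEnv.comps θ₀.tgt)]))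
    (hS : ∀ y ∈ Δ.toTEnv, ∃ w, S (.src y) = some w ∧ y.ty.SameCode (θ₀ y).tgt w)
    (h : State Θ H R (((S.set (.src x) (θ x).tgt).set .h (.tup (Δ.toTEnv.comps θ₀.tgt))).rebind
      Δ.toTEnv θ₀.tgt) θ) :
    Sim (M.ev call R H) ((funBody Δ.toTEnv Θ x N).ev pcall S)
      (CallPost τ₁ Δ τ₂ H θ₀ (θ x)) := by
  have hsim := hN.sim hcall (fun f hf τ₁ Δ τ₂ hσ => (hN.wf.2 f hf τ₁ Δ τ₂ hσ).subset) h
  set S₁ := ((S.set (.src x) (θ x).tgt).set .h (.tup (Δ.toTEnv.comps θ₀.tgt))).rebind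
    Δ.toTEnv θ₀.tgt
  have henter {P : PTerm L} {a : PAns L} :
      (split₂ (.src x) .h (unpack Δ.toTEnv P)).ev pcall S a ↔ P.ev pcall S₁ a := by
    refine (ev_split₂ hp (by simp)).trans (ev_unpack (w := θ₀.tgt) (post := [])
      (hN.wf.1.sublist hΔ) (by simp) fun y hy => ?_)
    simpa [ne_of_mem_of_not_mem hy hxΔ, Reps.tgt] using hS y hy
  refine (hsim.map id ?_).congr (fun _ => Ans.bind_ok.symm) fun _ => henter
  rintro _ R' H' _ ⟨β, θ', extra, rfl, rfl, hβ, -, hev⟩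
  refine ⟨_, .of_evolves hβ hx hΔ.subset hxΔ hθ hΘ hev, fun a => ?_⟩
  refine (ev_split₂ (PEnv.set_self ..) (by simp)).trans
    ((ev_unpack hN.wf.1 (PEnv.set_self ..) fun y hy => ⟨(θ y).tgt, ?_, (hev.same y hy).2⟩).trans
      (returns_triple (w₁ := β.tgt) (returns_var (by simp [PEnv.rebind]))
        (returns_var (PEnv.rebind_of_mem hx.1))
        ((hev.store.subset hΔ.subset).returns_pack fun y hy =>
          PEnv.rebind_of_mem (hΔ.subset hy)) a))
  simp [h.tgt y hy]

theorem State.of_captures (hfin : H.IsFinite) (hΔ : Stored H Δ.toTEnv θ)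
    (hR : ∀ y ∈ Δ.toTEnv, R y = some (θ y).src) (S : PEnv L) :
    State Δ.toTEnv H R (S.rebind Δ.toTEnv θ.tgt) θ :=
  ⟨hfin, hR, fun _ hy => PEnv.rebind_of_mem hy, hΔ,
    .of_normal θ fun _ hy => NTEnv.exists_ty_of_mem hy⟩

theorem Live.of_normal (Δ : NTEnv) (Γ : TEnv) : Live Δ.toTEnv Γ := by
  intro f hf τ₁ Δ' τ₂ hσ
  obtain ⟨τ, hτ⟩ := NTEnv.exists_ty_of_mem hf
  cases hσ.symm.trans hτ

theorem Live.append_rfun {f : Var} (hf : f.ty = .rfun τ₁ Δ τ₂) :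
    Live (Δ.toTEnv ++ [f]) (Δ.toTEnv ++ [f]) := by
  refine List.forall_mem_append.2 ⟨Live.of_normal Δ _, fun _ hg _ _ _ hσ => ?_⟩
  cases hf.symm.trans (List.mem_singleton.1 hg ▸ hσ)
  exact List.subset_append_left _ _

theorem State.enter_lam {W : PVal L} (hfin : H.IsFinite) (hΔ : Stored H Δ.toTEnv θ)
    (hβ : β.Valid H τ₁) (hdisj : ∀ y ∈ Δ.toTEnv, Disjoint β.own (θ y).own)
    (hx : x.ty = .n τ₁) (hxΔ : x ∉ Δ.toTEnv) (hR : ∀ y ∈ Δ.toTEnv, R y = some (θ y).src)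
    (S : PEnv L) :
    State (Δ.toTEnv ++ [x]) H (R.set x β.src)
      (((S.set (.src x) β.tgt).set .h W).rebind Δ.toTEnv θ.tgt) (θ.set x β) := by
  have hne {y : Var} (hy : y ∈ Δ.toTEnv) : y ≠ x := ne_of_mem_of_not_mem hy hxΔ
  have hcap := State.of_captures hfin hΔ (R := R.set x β.src)
    (fun y hy => (Function.update_of_ne (hne hy) ..).trans (hR y hy))
    ((S.set (.src x) β.tgt).set .h W)
  exact hcap.set_append (.of_normal _ _) hxΔ (Function.update_self ..)
    ((PEnv.rebind_of_notMem hxΔ).trans (by simp)) (by rwa [hx]) hdisj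
    fun _ _ _ hσ => by cases hx.symm.trans hσ

theorem State.enter_fix {W : PVal L} {f : Var} {u : Val L} {c : PVal L} (hfin : H.IsFinite)
    (hu : FunRel τ₁ Δ τ₂ θ u c) (hΔ : Stored H Δ.toTEnv θ) (hβ : β.Valid H τ₁)
    (hdisj : ∀ y ∈ Δ.toTEnv, Disjoint β.own (θ y).own) (hf : f.ty = .rfun τ₁ Δ τ₂)
    (hx : x.ty = .n τ₁) (hfΔ : f ∉ Δ.toTEnv) (hxΔ : x ∉ Δ.toTEnv ++ [f])
    (hR : ∀ y ∈ Δ.toTEnv, R y = some (θ y).src) (hS : S (.src f) = some c) :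
    State (Δ.toTEnv ++ [f] ++ [x]) H ((R.set f u).set x β.src)
      (((S.set (.src x) β.tgt).set .h W).rebind Δ.toTEnv θ.tgt)
      ((θ.set f ⟨u, c, ∅⟩).set x β) := by
  have hne {y : Var} (hy : y ∈ Δ.toTEnv ++ [f]) : y ≠ x := ne_of_mem_of_not_mem hy hxΔ
  have hfx : f ≠ x := hne (by simp)
  have hold {y : Var} (hy : y ∈ Δ.toTEnv) : y ≠ f := ne_of_mem_of_not_mem hy hfΔ
  have hcap := State.of_captures hfin hΔ (R := (R.set f u).set x β.src)
    (fun y hy => (Function.update_of_ne (hne (List.mem_append_left _ hy)) ..).trans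
      ((Function.update_of_ne (hold hy) ..).trans (hR y hy)))
    ((S.set (.src x) β.tgt).set .h W)
  have hself := hcap.set_append (.of_normal _ _) hfΔ (β := ⟨u, c, ∅⟩)
    ((Function.update_of_ne hfx ..).trans (Function.update_self ..))
    ((PEnv.rebind_of_notMem hfΔ).trans (by simp [hfx, hS])) (by rw [hf]; rfl)
    (fun _ _ => Set.empty_disjoint _) fun _ _ _ hσ => by
      cases hf.symm.trans hσ
      exact ⟨List.Subset.refl _, hu⟩
  refine hself.set_append (.append_rfun hf) hxΔ (Function.update_self ..)
    ((PEnv.rebind_of_notMem fun hm => hxΔ (List.mem_append_left _ hm)).trans (by simp))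
    (by rwa [hx]) (List.forall_mem_append.2 ⟨fun y hy => ?_, ?_⟩)
    fun _ _ _ hσ => by cases hx.symm.trans hσ
  · rw [θ.set_of_ne (hold hy)]
    exact hdisj y hy
  · rintro _ hg
    rw [List.mem_singleton.1 hg, Reps.set_self]
    exact Set.disjoint_empty _

theorem CallSim.sim_lam {k : ℕ} (hcall : CallSim (Val.call (L := L) k) (PVal.call k))
    {M : Term L} {N : PTerm L} (hfin : H.IsFinite) (hΔ : Stored H Δ.toTEnv θ)
    (hβ : β.Valid H τ₁) (hdisj : ∀ y ∈ Δ.toTEnv, Disjoint β.own (θ y).own) (hx : x.ty = .n τ₁)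
    (hN : Tr (Δ.toTEnv ++ [x]) M τ₂ (Δ.toTEnv ++ [x]) N) (hRS : Captures Δ R S θ) :
    Sim (Val.call (k + 1) (.clos x M R) β.src H)
      (PVal.call (k + 1) (.clos .p (funBody Δ.toTEnv (Δ.toTEnv ++ [x]) x N) S)
        (.tuple ![β.tgt, .tup (Δ.toTEnv.comps θ.tgt)]))
      (CallPost τ₁ Δ τ₂ H θ β) := by
  have hxΔ := hN.wf.notMem
  have hsim := sim_funBody hcall hN (θ := θ.set x β) (θ₀ := θ)
    (S := S.set .p (.tuple ![β.tgt, .tup (Δ.toTEnv.comps θ.tgt)]))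
    (List.sublist_append_left _ _) ⟨by simp, hx⟩ hxΔ
    (fun y hy => θ.set_of_ne (ne_of_mem_of_not_mem hy hxΔ) β)
    (by rw [footprint_append_set hxΔ, Reps.set_self]) (by simp)
    (fun y hy => by simpa using (hRS y hy).2)
    (by
      rw [Reps.set_self]
      exact .enter_lam hfin hΔ hβ hdisj hx hxΔ (fun y hy => (hRS y hy).1) _)
  rw [Reps.set_self] at hsim
  exact hsim

theorem CallSim.sim_fix {k : ℕ} (hcall : CallSim (Val.call (L := L) k) (PVal.call k)) {f : Var}
    {M : Term L} {N : PTerm L} (hfin : H.IsFinite) (hΔ : Stored H Δ.toTEnv θ)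
    (hβ : β.Valid H τ₁) (hdisj : ∀ y ∈ Δ.toTEnv, Disjoint β.own (θ y).own)
    (hf : f.ty = .rfun τ₁ Δ τ₂) (hx : x.ty = .n τ₁)
    (hN : Tr (Δ.toTEnv ++ [f, x]) M τ₂ (Δ.toTEnv ++ [f, x]) N) (hRS : Captures Δ R S θ) :
    Sim (Val.call (k + 1) (.rclos f x M R) β.src H)
      (PVal.call (k + 1) (.rclos (.src f) .p (funBody Δ.toTEnv (Δ.toTEnv ++ [f, x]) x N) S)
        (.tuple ![β.tgt, .tup (Δ.toTEnv.comps θ.tgt)]))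
      (CallPost τ₁ Δ τ₂ H θ β) := by
  have hΘ : Δ.toTEnv ++ [f, x] = Δ.toTEnv ++ [f] ++ [x] := by simp
  have hxΔf : x ∉ Δ.toTEnv ++ [f] := TEnv.WF.notMem (hΘ ▸ hN.wf)
  have hxΔ : x ∉ Δ.toTEnv := fun hm => hxΔf (List.mem_append_left _ hm)
  have hfΔ : f ∉ Δ.toTEnv := fun hm =>
    List.disjoint_of_nodup_append hN.wf.1 hm List.mem_cons_self
  set u : Val L := .rclos f x M R
  set c : PVal L := .rclos (.src f) .p (funBody Δ.toTEnv (Δ.toTEnv ++ [f, x]) x N) S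
  have hsim := sim_funBody hcall hN (θ := (θ.set f ⟨u, c, ∅⟩).set x β) (θ₀ := θ)
    (S := (S.set (.src f) c).set .p (.tuple ![β.tgt, .tup (Δ.toTEnv.comps θ.tgt)]))
    (List.sublist_append_left _ _) ⟨by simp, hx⟩ hxΔ
    (fun y hy => (Reps.set_of_ne _ (ne_of_mem_of_not_mem hy hxΔ) β).trans
      (θ.set_of_ne (ne_of_mem_of_not_mem hy hfΔ) _))
    (by rw [hΘ, footprint_append_set hxΔf, footprint_append_set hfΔ, Reps.set_self,
      Set.union_empty])
    (by simp) (fun y hy => by simpa [ne_of_mem_of_not_mem hy hfΔ] using (hRS y hy).2)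
    (by
      rw [Reps.set_self, hΘ]
      exact .enter_fix hfin (.fix hf hx hN hRS) hΔ hβ hdisj hf hx hfΔ hxΔf
        (fun y hy => (hRS y hy).1) (by simp))
  rw [Reps.set_self] at hsim
  exact hsim

theorem callSim (k : ℕ) : CallSim (Val.call (L := L) k) (PVal.call k) := by
  induction k with
  | zero =>
    intro _ _ _ _ _ _ _ _ _ hu
    cases hu <;> exact fun _ _ _ => ⟨fun _ h => h.elim, fun _ h => h.elim⟩
  | succ k hcall =>
    intro τ₁ Δ τ₂ u c H θ β hfin hu hΔ hβ hdisj
    cases hu with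
    | lam hx hN hRS => exact hcall.sim_lam hfin hΔ hβ hdisj hx hN hRS
    | fix hf hx hN hRS => exact hcall.sim_fix hfin hΔ hβ hdisj hf hx hN hRS

end Calls

end LinRef

open LinRef in
theorem mainTheorem1_general (L : Lang) (M : Term L) (τ : NTy) (N : PTerm L)
    (h : Tr [] M τ [] N) :
    Eval M Env.empty Heap.empty .fail ↔ PEval N PEnv.empty .fail := by
  rw [eval_iff_exists_ev, pEval_iff_exists_ev]
  refine exists_congr fun k => ?_
  have hstate : State [] (Heap.empty (L := L)) Env.empty PEnv.empty
      fun _ => ⟨.atom .unit, .unit, ∅⟩ :=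
    ⟨by simp [Heap.IsFinite, Heap.empty], by simp, by simp, .nil _ _, by simp [FunsRel]⟩
  have hsim := h.sim (callSim k) (by simp [Live]) hstate
  constructor
  · intro hfail
    obtain ⟨p, hp, ⟨⟩⟩ := hsim.1 _ hfail
    exact hp
  · intro hfail
    obtain ⟨a, ha, ⟨⟩⟩ := hsim.2 _ hfail
    exact ha

open LinRef in
theorem mainTheorem1 (L : Lang) (M : Term L) (τ : NTy) (hτ : τ.IsBase) (N : PTerm L)
    (h : Tr [] M τ [] N) :
    Eval M Env.empty Heap.empty .fail ↔ PEval N PEnv.empty .fail :=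
  mainTheorem1_general L M τ N h
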